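/- Let $R$ be an associative ring with identity; modules are left $R$-modules and complexes are cochain complexes of $R$-modules indexed by $\mathbb Z$. **Conventions.** A short exact sequence is *pure exact* if it stays exact after applying $M\otimes_R-$ for every right $R$-module $M$; its maps are then called *pure monic* and *pure epic*. A module is *pure injective* if it is injective with respect to pure exact sequences. A complex $X$ is *pure exact at $n$* if each of $d_X^{n-1}$ and $d_X^n$ is a pure epic followed by a pure monic and $0\to \operatorname{Ker} d_X^n\to X^n\to \operatorname{Coker} d_X^{n-1}\to 0$ is pure exact; it is *pure exact* if this holds for all $n$. A cochain map is a *pure quasi-isomorphism* if its mapping cone is pure exact. The objects of the pure derived category $\mathbf D_{\mathrm{pur}}(R)$ are all complexes, and two complexes are isomorphic in it if they are joined by a roof $\bullet\leftarrow\bullet\to\bullet$ of pure quasi-isomorphisms; $\mathbf D^b_{\mathrm{pur}}(R)$ consists of the complexes isomorphic in $\mathbf D_{\mathrm{pur}}(R)$ to a bounded complex. Let $\inf_p X$ and $\sup_p X$ be the infimum and supremum, in $\mathbb Z\cup\{\pm\infty\}$, of $\{n\in\mathbb Z : X \text{ is not pure exact at } n\}$ (so $\inf_pX=\infty$, $\sup_pX=-\infty$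 if $X$ is pure exact). A *pure injective resolution* of $Y$ is a pure quasi-isomorphism $Y\to I$ with $I$ a complex of pure injective modules such that the total complex functor $\operatorname{Hom}_R(-,I)$ takes pure exact complexes to pure exact complexes (of $\mathbb Z$-modules). We write $\operatorname{pid}_RY\le n$ if $Y$ has a pure injective resolution $Y\to I$ with $I^i=0$ for all $i>n$. For $Y\in\mathbf D^b_{\mathrm{pur}}(R)$, any complex $X$ and $i\in\mathbb Z$, put $\operatorname{Pext}^i_R(X,Y)=H^i\operatorname{Hom}_R(X,I)$, where $Y\to I$ is a pure injective resolution. A module is regarded as a complex concentrated in degree $0$; a complex is *contractible* if its identity map is homotopic to zero. **Theorem.** Let $Y\in\mathbf D^b_{\mathrm{pur}}(R)$ and $n\in\mathbb Z$. The following are equivalent. 1. $\operatorname{pid}_RY\le n$. 2. $\sup_pY\le n$, and for every pure injective resolution $Y\to I'$ the module $\operatorname{Ker} d_{I'}^n$ is pure injective. 3. For every pure injective resolution $Y\to I'$ there is an isomorphism of complexes $I'\cong I_1\oplus I_2$ with $I_1^i=0$ for all $i>n$ and $I_2$ contractible. 4. $\operatorname{Pext}^i_R(X,Y)=0$ for every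 $X\in\mathbf D_{\mathrm{pur}}(R)$ and every integer $i>n-\inf_pX$. 5. $\sup_pY\le n$, and $\operatorname{Pext}^{n+1}_R(M,Y)=0$ for every $R$-module $M$. -/

import Mathlib

open CategoryTheory CategoryTheory.Limits

noncomputable section

namespace PureDerived

universe w v

section Purity

variable (R : Type w) [Ring R]

/-- The relations `(m r) ⊗ a - m ⊗ (r a)` that cut the tensor product `M ⊗_R A` of a right module
and a left module over a (not necessarily commutative) ring out of `M ⊗_ℤ A`.  A right `R`-module
is a module over the opposite ring. -/
def balanced (M : Type v) [AddCommGroup M] [Module Rᵐᵒᵖ M] (A : Type v) [AddCommGroup A]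
    [Module R A] : Submodule ℤ (TensorProduct ℤ M A) :=
  Submodule.span ℤ {t | ∃ (m : M) (r : R) (a : A),
    t = TensorProduct.tmul ℤ (MulOpposite.op r • m) a - TensorProduct.tmul ℤ m (r • a)}

/-- The abelian group `M ⊗_R A` for a right `R`-module `M` and a left `R`-module `A`. -/
abbrev RTensor (M : Type v) [AddCommGroup M] [Module Rᵐᵒᵖ M] (A : Type v) [AddCommGroup A]
    [Module R A] : Type v :=
  TensorProduct ℤ M A ⧸ balanced R M A

variable {R}

theorem balanced_le_comap (M : Type v) [AddCommGroup M] [Module Rᵐᵒᵖ M] {A B : Type v}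
    [AddCommGroup A] [Module R A] [AddCommGroup B] [Module R B] (f : A →ₗ[R] B) :
    balanced R M A ≤
      (balanced R M B).comap (LinearMap.lTensor M f.toAddMonoidHom.toIntLinearMap) := by
  refine Submodule.span_le.2 ?_
  rintro _ ⟨m, r, a, rfl⟩
  refine Submodule.subset_span ⟨m, r, f a, ?_⟩
  simp

/-- The map `M ⊗_R f : M ⊗_R A → M ⊗_R B` induced by an `R`-linear map `f : A → B`. -/
def RTensor.map (M : Type v) [AddCommGroup M] [Module Rᵐᵒᵖ M] {A B : Type v}
    [AddCommGroup A] [Module R A] [AddCommGroup B] [Module R B] (f : A →ₗ[R] B) :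
    RTensor R M A →ₗ[ℤ] RTensor R M B :=
  Submodule.mapQ _ _ (LinearMap.lTensor M f.toAddMonoidHom.toIntLinearMap)
    (balanced_le_comap M f)

/-- `0 → A → B → C → 0` is a pure exact sequence of left `R`-modules: it is short exact and stays
short exact after applying `M ⊗_R -` for every right `R`-module `M`. -/
structure PureShortExact {A B C : Type v} [AddCommGroup A] [Module R A] [AddCommGroup B]
    [Module R B] [AddCommGroup C] [Module R C] (f : A →ₗ[R] B) (g : B →ₗ[R] C) : Prop where
  injective : Function.Injective f
  exact : Function.Exact f g
  surjective : Function.Surjective g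
  tensor_injective : ∀ (M : Type v) [AddCommGroup M] [Module Rᵐᵒᵖ M],
    Function.Injective (RTensor.map M f)
  tensor_exact : ∀ (M : Type v) [AddCommGroup M] [Module Rᵐᵒᵖ M],
    Function.Exact (RTensor.map M f) (RTensor.map M g)
  tensor_surjective : ∀ (M : Type v) [AddCommGroup M] [Module Rᵐᵒᵖ M],
    Function.Surjective (RTensor.map M g)

/-- `f` is pure monic: it is the first map of a pure exact sequence (with its cokernel). -/
def PureMono {A B : Type v} [AddCommGroup A] [Module R A] [AddCommGroup B] [Module R B]
    (f : A →ₗ[R] B) : Prop :=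
  PureShortExact f (LinearMap.range f).mkQ

/-- `g` is pure epic: it is the second map of a pure exact sequence (with its kernel). -/
def PureEpi {B C : Type v} [AddCommGroup B] [Module R B] [AddCommGroup C] [Module R C]
    (g : B →ₗ[R] C) : Prop :=
  PureShortExact (LinearMap.ker g).subtype g

variable (R) in
/-- `E` is pure injective: it is injective with respect to pure exact sequences. -/
def PureInjective (E : Type v) [AddCommGroup E] [Module R E] : Prop :=
  ∀ (A B C : Type v) [AddCommGroup A] [Module R A] [AddCommGroup B] [Module R B]
    [AddCommGroup C] [Module R C] (f : A →ₗ[R] B) (g : B →ₗ[R] C), PureShortExact f g →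
    ∀ h : A →ₗ[R] E, ∃ k : B →ₗ[R] E, k ∘ₗ f = h

end Purity

section Complexes

variable {R : Type w} [Ring R]

/-- A homomorphism decomposes as a pure epic followed by a pure monic. -/
def Decomposes {A B : ModuleCat.{v} R} (d : A ⟶ B) : Prop :=
  ∃ (D : ModuleCat.{v} R) (p : A →ₗ[R] D) (j : D →ₗ[R] B),
    PureEpi p ∧ PureMono j ∧ j ∘ₗ p = d.hom

/-- The complex `X` is pure exact at `n`: the differentials `d^{n-1}` and `d^n` decompose as a pure
epic followed by a pure monic, and `0 → Ker d^n → X^n → Coker d^{n-1} → 0` is pure exact. -/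
def PureExactAt (X : CochainComplex (ModuleCat.{v} R) ℤ) (n : ℤ) : Prop :=
  Decomposes (X.d (n - 1) n) ∧ Decomposes (X.d n (n + 1)) ∧
    PureShortExact (LinearMap.ker (X.d n (n + 1)).hom).subtype
      (LinearMap.range (X.d (n - 1) n).hom).mkQ

/-- A complex is pure exact if it is pure exact at every `n`. -/
def PureExact (X : CochainComplex (ModuleCat.{v} R) ℤ) : Prop :=
  ∀ n : ℤ, PureExactAt X n

/-- A cochain map is a pure quasi-isomorphism if its mapping cone is pure exact. -/
def PureQuasiIso {X Y : CochainComplex (ModuleCat.{v} R) ℤ} (f : X ⟶ Y) : Prop :=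
  PureExact (CochainComplex.mappingCone f)

/-- `X` and `Y` are isomorphic in the pure derived category: they are connected by a roof
`X ← Z → Y` of pure quasi-isomorphisms. -/
def IsoInDpur (X Y : CochainComplex (ModuleCat.{v} R) ℤ) : Prop :=
  ∃ (Z : CochainComplex (ModuleCat.{v} R) ℤ) (s : Z ⟶ X) (a : Z ⟶ Y),
    PureQuasiIso s ∧ PureQuasiIso a

/-- `X^i = 0` for `|i|` large. -/
def IsBounded (X : CochainComplex (ModuleCat.{v} R) ℤ) : Prop :=
  ∃ a b : ℤ, ∀ i : ℤ, i < a ∨ b < i → IsZero (X.X i)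

/-- `X` lies in the bounded pure derived category, as a full subcategory (closed under
isomorphisms) of the pure derived category, whose objects are all complexes. -/
def InDbpur (X : CochainComplex (ModuleCat.{v} R) ℤ) : Prop :=
  ∃ B : CochainComplex (ModuleCat.{v} R) ℤ, IsBounded B ∧ IsoInDpur X B

/-- An integer as an extended real. -/
abbrev ext (n : ℤ) : EReal := ((n : ℝ) : EReal)

/-- `inf_p X`, the infimum of the `n` at which `X` is not pure exact (so `⊤` if there is none and
`⊥` if these `n` are not bounded below). -/
def infp (X : CochainComplex (ModuleCat.{v} R) ℤ) : EReal :=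
  sInf (ext '' {n : ℤ | ¬ PureExactAt X n})

/-- `sup_p X`, the supremum of the `n` at which `X` is not pure exact (so `⊥` if there is none and
`⊤` if these `n` are not bounded above). -/
def supp (X : CochainComplex (ModuleCat.{v} R) ℤ) : EReal :=
  sSup (ext '' {n : ℤ | ¬ PureExactAt X n})

/-- The total Hom complex `Hom_R(X, Y)`, as a complex of `ℤ`-modules: `∏ᵢ Hom(X^i, Y^{i+n})` in
degree `n`, with `d φ = d_Y φ - (-1)^n φ d_X`. -/
def homComplex (X Y : CochainComplex (ModuleCat.{v} R) ℤ) :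
    CochainComplex (ModuleCat.{v} ℤ) ℤ where
  X n := ModuleCat.of ℤ (CochainComplex.HomComplex.Cochain X Y n)
  d n m := ModuleCat.ofHom (CochainComplex.HomComplex.δ_hom ℤ X Y n m)
  shape n m h := by
    refine ModuleCat.hom_ext (LinearMap.ext fun z => ?_)
    exact CochainComplex.HomComplex.δ_shape n m h z
  d_comp_d' n m k _ _ := by
    refine ModuleCat.hom_ext (LinearMap.ext fun z => ?_)
    exact CochainComplex.HomComplex.δ_δ n m k z

/-- `f : Y ⟶ I` is a pure injective resolution of `Y`: a pure quasi-isomorphism to a complex of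
pure injective modules such that `Hom_R(-, I)` preserves pure exact complexes. -/
structure IsPureInjectiveResolution {Y I : CochainComplex (ModuleCat.{v} R) ℤ} (f : Y ⟶ I) :
    Prop where
  pureQuasiIso : PureQuasiIso f
  pureInjective : ∀ i : ℤ, PureInjective R (I.X i)
  hom_preserves : ∀ X : CochainComplex (ModuleCat.{v} R) ℤ, PureExact X →
    PureExact (homComplex X I)

/-- There is a pure injective resolution `Y ⟶ I` with `I^i = 0` for all `i > m`. -/
def HasResolutionUpTo (Y : CochainComplex (ModuleCat.{v} R) ℤ) (m : ℤ) : Prop :=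
  ∃ (I : CochainComplex (ModuleCat.{v} R) ℤ) (f : Y ⟶ I), IsPureInjectiveResolution f ∧
    ∀ i : ℤ, m < i → IsZero (I.X i)

/-- The pure injective dimension of `Y`: the least `m` such that `Y` has a pure injective
resolution vanishing in degrees `> m`; it is `⊥` if every `m` will do and `⊤` if none will. -/
def pid (Y : CochainComplex (ModuleCat.{v} R) ℤ) : EReal :=
  sInf (ext '' {m : ℤ | HasResolutionUpTo Y m})

open Classical in
/-- A chosen pure injective resolution of `Y` (and `Y` itself if there is none; every complex in
the bounded pure derived category has one). -/
def chosenResolution (Y : CochainComplex (ModuleCat.{v} R) ℤ) :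
    CochainComplex (ModuleCat.{v} R) ℤ :=
  if h : ∃ (I : CochainComplex (ModuleCat.{v} R) ℤ) (f : Y ⟶ I), IsPureInjectiveResolution f
  then h.choose else Y

/-- The right pure derived functor of Hom, `RHom_R(X, Y) = Hom_R(X, I)` with `Y ⟶ I` a pure
injective resolution. -/
def RHom (X Y : CochainComplex (ModuleCat.{v} R) ℤ) : CochainComplex (ModuleCat.{v} ℤ) ℤ :=
  homComplex X (chosenResolution Y)

/-- `Pext^i_R(X, Y) = H^i RHom_R(X, Y)`. -/
def Pext (i : ℤ) (X Y : CochainComplex (ModuleCat.{v} R) ℤ) : ModuleCat.{v} ℤ :=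
  (RHom X Y).homology i

/-- A module as a complex concentrated in degree `0`. -/
abbrev stalk (M : ModuleCat.{v} R) : CochainComplex (ModuleCat.{v} R) ℤ :=
  (HomologicalComplex.single (ModuleCat.{v} R) (ComplexShape.up ℤ) 0).obj M

/-- A complex is contractible if its identity map is homotopic to zero. -/
def Contractible (X : CochainComplex (ModuleCat.{v} R) ℤ) : Prop :=
  Nonempty (Homotopy (𝟙 X) 0)

end Complexes

end PureDerived

end

universe u

/-! The equivalences all pass through one property of a pure injective resolution `Y ⟶ I`, called
`SplitAbove`: the identity of `I` is null-homotopic in degrees `> n`. Any resolution is a retract up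
to homotopy of any other, so the property spreads from a resolution vanishing above `n` to all of
them. Conversely, cutting the contraction off below `n` makes it the null-homotopy of an idempotent
that is `1` above `n` and `0` below. Splitting the idempotent peels off a contractible summand and
leaves a resolution vanishing above `n` (`SplitAbove.exists_iso_biprod`).

If `I` is pure exact above `n` and `Ker d^n` is pure injective, the pure inclusion `Ker d^n ⊆ I^n`
splits, hence so does `I^n → Ker d^{n+1}`. The next kernel is then a retract of `I^n`, and induction
contracts `I` above `n` (`PureTail.splitAbove`). Vanishing of `Pext` on the module `Ker d^m` lifts
its inclusion into `I^m`, which is a section of `I^{m-1} → Ker d^m`. In the other direction, a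
cocycle on `X` is killed on the pure exact low-degree truncation of `X` because `Hom(-, I)`
preserves pure exactness, and elsewhere by the contraction of `I` (`SplitAbove.exists_primitive`).

The groundwork is duality: maps `A → N⁺` into a character module are characters of `N ⊗ A`. Hence
pure exactness is exactness of `Hom(-, E)` for all pure injective `E`, and `A → A⁺⁺` is a pure
embedding into a pure injective module, from which resolutions of bounded below complexes are built.
They are carried along roofs by orthogonality in the homotopy category. -/

noncomputable section

namespace PureDerived

universe w v

/-! ### Character modules, pure embeddings and pure submodules -/

section Duality

variable {R : Type w} [Ring R]

/-- The character module of a right module, a left module. -/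
def RightDual (N : Type v) [AddCommGroup N] : Type v := CharacterModule N

instance (N : Type v) [AddCommGroup N] : AddCommGroup (RightDual N) :=
  inferInstanceAs (AddCommGroup (N →+ AddCircle (1 : ℚ)))

instance (N : Type v) [AddCommGroup N] : FunLike (RightDual N) N (AddCircle (1 : ℚ)) :=
  inferInstanceAs (FunLike (N →+ AddCircle (1 : ℚ)) _ _)

instance (N : Type v) [AddCommGroup N] :
    AddMonoidHomClass (RightDual N) N (AddCircle (1 : ℚ)) :=
  inferInstanceAs (AddMonoidHomClass (N →+ AddCircle (1 : ℚ)) _ _)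

theorem RightDual.ext {N : Type v} [AddCommGroup N] {c c' : RightDual N}
    (h : ∀ x, c x = c' x) : c = c' := DFunLike.ext _ _ h

theorem RightDual.add_apply {N : Type v} [AddCommGroup N] (c c' : RightDual N) (x : N) :
    (c + c') x = c x + c' x := rfl

theorem RightDual.zsmul_apply {N : Type v} [AddCommGroup N] (k : ℤ) (c : RightDual N) (x : N) :
    (k • c) x = k • c x := rfl

theorem RightDual.zero_apply {N : Type v} [AddCommGroup N] (x : N) :
    (0 : RightDual N) x = 0 := rfl

instance (N : Type v) [AddCommGroup N] [Module Rᵐᵒᵖ N] : Module R (RightDual N) where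
  smul r c := AddMonoidHom.comp (show N →+ AddCircle (1 : ℚ) from c)
    (DistribSMul.toAddMonoidHom N (MulOpposite.op r))
  one_smul c := RightDual.ext fun x => congrArg c (one_smul _ x)
  mul_smul r s c := RightDual.ext fun x => congrArg c (mul_smul (MulOpposite.op s) (MulOpposite.op r) x)
  smul_zero _ := rfl
  smul_add _ _ _ := rfl
  add_smul r s c := RightDual.ext fun x =>
    (congrArg c (add_smul (MulOpposite.op r) (MulOpposite.op s) x)).trans (map_add c _ _)
  zero_smul c := RightDual.ext fun x => (congrArg c (zero_smul _ x)).trans (map_zero c)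

theorem RightDual.smul_apply {N : Type v} [AddCommGroup N] [Module Rᵐᵒᵖ N] (r : R)
    (c : RightDual N) (x : N) : (r • c) x = c (MulOpposite.op r • x) := rfl

/-- The character module of a left module, a right module. -/
def LeftDual (A : Type v) [AddCommGroup A] : Type v := CharacterModule A

instance (N : Type v) [AddCommGroup N] : AddCommGroup (LeftDual N) :=
  inferInstanceAs (AddCommGroup (N →+ AddCircle (1 : ℚ)))

instance (N : Type v) [AddCommGroup N] : FunLike (LeftDual N) N (AddCircle (1 : ℚ)) :=
  inferInstanceAs (FunLike (N →+ AddCircle (1 : ℚ)) _ _)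

instance (N : Type v) [AddCommGroup N] :
    AddMonoidHomClass (LeftDual N) N (AddCircle (1 : ℚ)) :=
  inferInstanceAs (AddMonoidHomClass (N →+ AddCircle (1 : ℚ)) _ _)

theorem LeftDual.ext {N : Type v} [AddCommGroup N] {c c' : LeftDual N}
    (h : ∀ x, c x = c' x) : c = c' := DFunLike.ext _ _ h

instance (A : Type v) [AddCommGroup A] [Module R A] : Module Rᵐᵒᵖ (LeftDual A) where
  smul r c := AddMonoidHom.comp (show A →+ AddCircle (1 : ℚ) from c)
    (DistribSMul.toAddMonoidHom A r.unop)
  one_smul c := LeftDual.ext fun x => congrArg c (one_smul R x)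
  mul_smul r s c := LeftDual.ext fun x => congrArg c (mul_smul s.unop r.unop x)
  smul_zero _ := rfl
  smul_add _ _ _ := rfl
  add_smul r s c := LeftDual.ext fun x =>
    (congrArg c (add_smul r.unop s.unop x)).trans (map_add c _ _)
  zero_smul c := LeftDual.ext fun x => (congrArg c (zero_smul R x)).trans (map_zero c)

/-- Evaluation, as a map from a module to its double character module. -/
def doubleDualMap (A : Type v) [AddCommGroup A] [Module R A] :
    A →ₗ[R] RightDual (LeftDual A) where
  toFun a := show LeftDual A →+ AddCircle (1 : ℚ) from
    { toFun := fun c => c a, map_zero' := rfl, map_add' := fun _ _ => rfl }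
  map_add' a b := RightDual.ext fun c => map_add c a b
  map_smul' _ _ := rfl

section

variable {M N : Type v} [AddCommGroup M] [Module Rᵐᵒᵖ M] [AddCommGroup N] [Module Rᵐᵒᵖ N]
  {A B C : Type v} [AddCommGroup A] [Module R A] [AddCommGroup B] [Module R B]
  [AddCommGroup C] [Module R C]

variable (R) in
/-- The class of a pure tensor. -/
def RTensor.tmul (m : M) (a : A) : RTensor R M A :=
  (balanced R M A).mkQ (TensorProduct.tmul ℤ m a)

theorem RTensor.hom_ext {T : Type*} [AddCommGroup T] {f g : RTensor R M A →ₗ[ℤ] T}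
    (h : ∀ m a, f (RTensor.tmul R m a) = g (RTensor.tmul R m a)) : f = g :=
  Submodule.linearMap_qext _ (TensorProduct.ext' fun m a => h m a)

theorem RTensor.tmul_smul (m : M) (r : R) (a : A) :
    RTensor.tmul R m (r • a) = RTensor.tmul R (MulOpposite.op r • m) a := by
  symm
  refine (Submodule.Quotient.eq _).2 ?_
  exact Submodule.subset_span ⟨m, r, a, rfl⟩

theorem RTensor.map_comp_map (g : B →ₗ[R] C) (f : A →ₗ[R] B) :
    RTensor.map M g ∘ₗ RTensor.map M f = RTensor.map M (g ∘ₗ f) :=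
  RTensor.hom_ext fun _ _ => rfl

/-- A homomorphism into a character module induces a character of the tensor product. -/
def charOfHom (φ : A →ₗ[R] RightDual N) : RTensor R N A →ₗ[ℤ] AddCircle (1 : ℚ) :=
  Submodule.liftQ _ (TensorProduct.lift (LinearMap.mk₂ ℤ (fun (n : N) (a : A) => φ a n)
    (fun n n' a => map_add (φ a) n n')
    (fun k n a => map_zsmul (φ a) k n)
    (fun n a a' => by rw [map_add, RightDual.add_apply])
    (fun k n a => by rw [map_zsmul, RightDual.zsmul_apply]))) (by
      refine Submodule.span_le.2 ?_
      rintro _ ⟨m, r, a, rfl⟩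
      refine (map_sub (TensorProduct.lift _) _ _).trans (sub_eq_zero.2 ?_)
      change φ a (MulOpposite.op r • m) = φ (r • a) m
      rw [φ.map_smul r a, RightDual.smul_apply])

/-- A character of the tensor product induces a homomorphism into a character module. -/
def homOfChar (χ : RTensor R N A →ₗ[ℤ] AddCircle (1 : ℚ)) : A →ₗ[R] RightDual N where
  toFun a := show N →+ AddCircle (1 : ℚ) from
    { toFun := fun n => χ (RTensor.tmul R n a)
      map_zero' := by simp [RTensor.tmul]
      map_add' := fun n n' => by
        simp only [RTensor.tmul]
        rw [TensorProduct.add_tmul, map_add, map_add] }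
  map_add' a a' := RightDual.ext fun n => by
    change χ _ = χ _ + χ _
    simp only [RTensor.tmul]
    rw [TensorProduct.tmul_add, map_add, map_add]
  map_smul' r a := RightDual.ext fun n => by
    change χ (RTensor.tmul R n (r • a)) = χ (RTensor.tmul R (MulOpposite.op r • n) a)
    rw [RTensor.tmul_smul]

/-- Homomorphisms into the character module of `N` extend along `f` if `f` stays injective
after tensoring with `N`. -/
theorem exists_extension_rightDual {f : A →ₗ[R] B}
    (hf : Function.Injective (RTensor.map N f)) (φ : A →ₗ[R] RightDual N) :
    ∃ ψ : B →ₗ[R] RightDual N, ψ ∘ₗ f = φ := by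
  obtain ⟨χ, hχ⟩ := CharacterModule.dual_surjective_of_injective (RTensor.map N f) hf
    (charOfHom φ).toAddMonoidHom
  refine ⟨homOfChar (AddMonoidHom.toIntLinearMap (show _ →+ AddCircle (1 : ℚ) from χ)), ?_⟩
  refine LinearMap.ext fun a => RightDual.ext fun n => ?_
  exact DFunLike.congr_fun hχ (RTensor.tmul R n a)

/-- Characters separate the points of `N ⊗ A`, and one that comes from `N ⊗ B` vanishes wherever `N
⊗ f` does. -/
theorem tensor_injective_of_extension {f : A →ₗ[R] B}
    (hf : ∀ φ : A →ₗ[R] RightDual N, ∃ ψ : B →ₗ[R] RightDual N, ψ ∘ₗ f = φ) :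
    Function.Injective (RTensor.map N f) := by
  rw [injective_iff_map_eq_zero]
  intro t ht
  refine CharacterModule.eq_zero_of_character_apply fun χ => ?_
  obtain ⟨ψ, hψ⟩ := hf (homOfChar (AddMonoidHom.toIntLinearMap
    (show _ →+ AddCircle (1 : ℚ) from χ)))
  have : charOfHom ψ ∘ₗ RTensor.map N f =
      AddMonoidHom.toIntLinearMap (show _ →+ AddCircle (1 : ℚ) from χ) := by
    refine RTensor.hom_ext fun n a => ?_
    exact DFunLike.congr_fun (LinearMap.congr_fun hψ a) n
  have h2 := LinearMap.congr_fun this t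
  rw [LinearMap.comp_apply, ht, map_zero] at h2
  exact h2.symm

theorem tensor_surjective {g : B →ₗ[R] C} (hg : Function.Surjective g) :
    Function.Surjective (RTensor.map M g) := by
  intro t
  obtain ⟨t, rfl⟩ := Submodule.mkQ_surjective _ t
  obtain ⟨s, rfl⟩ := LinearMap.lTensor_surjective M (g := g.toAddMonoidHom.toIntLinearMap) hg t
  exact ⟨(balanced R M B).mkQ s, rfl⟩

theorem exists_factor_of_surjective {f : A →ₗ[R] B} (hf : Function.Surjective f) (g : A →ₗ[R] C)
    (h : LinearMap.ker f ≤ LinearMap.ker g) : ∃ k : B →ₗ[R] C, k ∘ₗ f = g := by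
  refine ⟨(LinearMap.ker f).liftQ g h ∘ₗ (f.quotKerEquivOfSurjective hf).symm.toLinearMap, ?_⟩
  refine LinearMap.ext fun b => ?_
  have : (f.quotKerEquivOfSurjective hf).symm (f b) = (LinearMap.ker f).mkQ b := by
    rw [LinearEquiv.symm_apply_eq]; rfl
  simp only [LinearMap.comp_apply, LinearEquiv.coe_coe, this]
  rfl

/-- Right exactness of the tensor product. -/
theorem tensor_exact {f : A →ₗ[R] B} {g : B →ₗ[R] C} (h : Function.Exact f g)
    (hg : Function.Surjective g) : Function.Exact (RTensor.map M f) (RTensor.map M g) := by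
  intro t
  constructor
  · intro ht
    -- A character of the cokernel of `M ⊗ f` not killing `t` corresponds to a map `B → M⁺` that
    -- kills `ker g`. It factors through `C`, so the character does vanish at `t`.
    by_contra hn
    let S := LinearMap.range (RTensor.map M f)
    have hne : S.mkQ t ≠ 0 := by
      intro h0
      exact hn ((Submodule.Quotient.mk_eq_zero _).1 h0)
    obtain ⟨χ, hχ⟩ := CharacterModule.exists_character_apply_ne_zero_of_ne_zero hne
    let χ' : RTensor R M B →ₗ[ℤ] AddCircle (1 : ℚ) :=
      AddMonoidHom.toIntLinearMap (show _ →+ AddCircle (1 : ℚ) from χ) ∘ₗ S.mkQ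
    have hker : LinearMap.ker g ≤ LinearMap.ker (homOfChar χ') := by
      intro b hb
      obtain ⟨a, rfl⟩ := (h b).1 hb
      refine RightDual.ext fun m => ?_
      change χ (S.mkQ (RTensor.map M f (RTensor.tmul R m a))) = 0
      have : S.mkQ (RTensor.map M f (RTensor.tmul R m a)) = 0 :=
        (Submodule.Quotient.mk_eq_zero _).2 ⟨_, rfl⟩
      rw [this, map_zero]
    obtain ⟨θ, hθ⟩ := exists_factor_of_surjective hg (homOfChar χ') hker
    have h3 : charOfHom θ ∘ₗ RTensor.map M g = χ' := by
      refine RTensor.hom_ext fun n a => ?_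
      exact DFunLike.congr_fun (LinearMap.congr_fun hθ a) n
    have h4 := LinearMap.congr_fun h3 t
    rw [LinearMap.comp_apply, ht, map_zero] at h4
    exact hχ h4.symm
  · rintro ⟨s, rfl⟩
    have : RTensor.map M g ∘ₗ RTensor.map M f = 0 := by
      rw [RTensor.map_comp_map]
      refine RTensor.hom_ext fun m a => ?_
      change RTensor.tmul R m (g (f a)) = 0
      rw [(h (f a)).2 ⟨a, rfl⟩]
      simp [RTensor.tmul]
    exact LinearMap.congr_fun this s

/-- A character module is pure injective. -/
theorem pureInjective_rightDual : PureInjective R (RightDual N) :=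
  fun _ _ _ _ _ _ _ _ _ _ _ hfg φ => exists_extension_rightDual (hfg.tensor_injective N) φ

/-- A short exact sequence whose first map has the extension property for pure injective modules
is pure exact. -/
theorem pureShortExact_of_extension {f : A →ₗ[R] B} {g : B →ₗ[R] C}
    (hf : Function.Injective f) (h : Function.Exact f g) (hg : Function.Surjective g)
    (hext : ∀ (E : Type v) [AddCommGroup E] [Module R E], PureInjective R E →
      ∀ φ : A →ₗ[R] E, ∃ ψ : B →ₗ[R] E, ψ ∘ₗ f = φ) : PureShortExact f g where
  injective := hf
  exact := h
  surjective := hg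
  tensor_injective _ _ _ :=
    tensor_injective_of_extension fun φ => hext _ pureInjective_rightDual φ
  tensor_exact _ _ _ := tensor_exact h hg
  tensor_surjective _ _ _ := tensor_surjective hg

theorem PureInjective.of_retract {E E' : Type v} [AddCommGroup E] [Module R E] [AddCommGroup E']
    [Module R E'] (h : PureInjective R E) (i : E' →ₗ[R] E) (p : E →ₗ[R] E')
    (hpi : p ∘ₗ i = LinearMap.id) : PureInjective R E' := by
  intro A B C _ _ _ _ _ _ f g hfg φ
  obtain ⟨k, hk⟩ := h A B C f g hfg (i ∘ₗ φ)
  exact ⟨p ∘ₗ k, by rw [LinearMap.comp_assoc, hk, ← LinearMap.comp_assoc, hpi,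
    LinearMap.id_comp]⟩

variable (R) in
/-- `E` is injective with respect to pure exact sequences, compatibly in additive families of
homomorphisms. -/
def AdditivelyPureInjective (E : Type v) [AddCommGroup E] [Module R E] : Prop :=
  ∀ (A B C : Type v) [AddCommGroup A] [Module R A] [AddCommGroup B] [Module R B]
    [AddCommGroup C] [Module R C] (f : A →ₗ[R] B) (g : B →ₗ[R] C), PureShortExact f g →
    ∀ (H : Type v) [AddCommGroup H] (φ : H →+ (A →ₗ[R] E)),
      ∃ ψ : H →+ (B →ₗ[R] E), ∀ h, ψ h ∘ₗ f = φ h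

theorem AdditivelyPureInjective.pureInjective {E : Type v} [AddCommGroup E] [Module R E]
    (h : AdditivelyPureInjective R E) : PureInjective R E := by
  intro A B C _ _ _ _ _ _ f g hfg φ
  -- A single homomorphism is the family `k ↦ k • φ` over `ℤ`, lifted to the universe of the
  -- modules.
  obtain ⟨ψ, hψ⟩ := h A B C f g hfg (ULift ℤ)
    ((zmultiplesHom _ φ).comp AddEquiv.ulift.toAddMonoidHom)
  exact ⟨ψ ⟨1⟩, (hψ ⟨1⟩).trans (one_smul ℤ φ)⟩

theorem additivelyPureInjective_of_subsingleton (E : Type v) [AddCommGroup E] [Module R E]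
    [Subsingleton E] : AdditivelyPureInjective R E := by
  intro A B C _ _ _ _ _ _ f g _ H _ φ
  exact ⟨0, fun h => LinearMap.ext fun x => Subsingleton.elim _ _⟩

-- An additive family `H → Hom(A, N⁺)` is the same as one homomorphism `A → (N ⊗ H)⁺`, whose target
-- is again a character module. Extending that one map extends the whole family at once.
open TensorProduct in
theorem additivelyPureInjective_rightDual : AdditivelyPureInjective R (RightDual N) := by
  intro A B C _ _ _ _ _ _ f g hfg H _ φ
  let χ (a : A) : N ⊗[ℤ] H →ₗ[ℤ] AddCircle (1 : ℚ) :=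
    TensorProduct.lift (LinearMap.mk₂ ℤ (fun (n : N) (h : H) => φ h a n)
      (fun n n' h => map_add (φ h a) n n')
      (fun k n h => map_zsmul (φ h a) k n)
      (fun n h h' => by rw [map_add, LinearMap.add_apply, RightDual.add_apply])
      (fun k n h => by rw [map_zsmul, LinearMap.smul_apply, RightDual.zsmul_apply]))
  let Φ : A →ₗ[R] RightDual (N ⊗[ℤ] H) :=
    { toFun := fun a => show N ⊗[ℤ] H →+ AddCircle (1 : ℚ) from (χ a).toAddMonoidHom
      map_add' := fun a a' => RightDual.ext fun t => by
        have : χ (a + a') = χ a + χ a' := TensorProduct.ext' fun n h => by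
          change φ h (a + a') n = φ h a n + φ h a' n
          rw [map_add, RightDual.add_apply]
        exact LinearMap.congr_fun this t
      map_smul' := fun r a => RightDual.ext fun t => by
        have : χ (r • a) = χ a ∘ₗ
            ((DistribSMul.toAddMonoidHom _ (MulOpposite.op r)).toIntLinearMap) :=
          TensorProduct.ext' fun n h => by
            change φ h (r • a) n = φ h a (MulOpposite.op r • n)
            rw [(φ h).map_smul, RightDual.smul_apply]
        exact LinearMap.congr_fun this t }
  obtain ⟨Ψ, hΨ⟩ := exists_extension_rightDual (hfg.tensor_injective _) Φ
  have hadd (h : H) (b : B) (n n' : N) :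
      Ψ b ((n + n') ⊗ₜ h) = Ψ b (n ⊗ₜ h) + Ψ b (n' ⊗ₜ h) := by
    rw [TensorProduct.add_tmul, map_add]
  have hzero (h : H) (b : B) : Ψ b ((0 : N) ⊗ₜ h) = 0 := by
    rw [TensorProduct.zero_tmul, map_zero]
  let ψ (h : H) : B →ₗ[R] RightDual N :=
    { toFun := fun b => show N →+ AddCircle (1 : ℚ) from
        { toFun := fun n => Ψ b (n ⊗ₜ h), map_zero' := hzero h b, map_add' := hadd h b }
      map_add' := fun b b' => RightDual.ext fun n => by
        change Ψ (b + b') (n ⊗ₜ h) = _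
        rw [map_add]
        rfl
      map_smul' := fun r b => RightDual.ext fun n => by
        change Ψ (r • b) (n ⊗ₜ h) = _
        rw [map_smul]
        rfl }
  refine ⟨AddMonoidHom.mk' ψ fun h h' => LinearMap.ext fun b => RightDual.ext fun n => ?_,
    fun h => LinearMap.ext fun a => RightDual.ext fun n => ?_⟩
  · change Ψ b (n ⊗ₜ (h + h')) = Ψ b (n ⊗ₜ h) + Ψ b (n ⊗ₜ h')
    rw [TensorProduct.tmul_add, map_add]
  · exact DFunLike.congr_fun (LinearMap.congr_fun hΨ a) (n ⊗ₜ h)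

/-- Every homomorphism into a character module extends along the evaluation map into the double
character module. -/
theorem exists_extension_doubleDual (φ : A →ₗ[R] RightDual N) :
    ∃ ψ : RightDual (LeftDual A) →ₗ[R] RightDual N, ψ ∘ₗ doubleDualMap A = φ := by
  -- The transpose `N → A⁺` of `φ`. The extension to `A⁺⁺` is precomposition with it.
  let ev : N →+ LeftDual A :=
    { toFun := fun n => show A →+ AddCircle (1 : ℚ) from
        { toFun := fun a => φ a n
          map_zero' := by rw [map_zero, RightDual.zero_apply]
          map_add' := fun a a' => by rw [map_add, RightDual.add_apply] }
      map_zero' := LeftDual.ext fun a => map_zero (φ a)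
      map_add' := fun n n' => LeftDual.ext fun a => map_add (φ a) n n' }
  have hev (r : R) (n : N) : ev (MulOpposite.op r • n) = MulOpposite.op r • ev n :=
    LeftDual.ext fun a => by
      change φ a (MulOpposite.op r • n) = φ (r • a) n
      rw [φ.map_smul, RightDual.smul_apply]
  refine ⟨{ toFun := fun c => show N →+ AddCircle (1 : ℚ) from
              AddMonoidHom.comp (show LeftDual A →+ AddCircle (1 : ℚ) from c) ev
            map_add' := fun _ _ => rfl
            map_smul' := fun r c => RightDual.ext fun n => ?_ }, rfl⟩
  change c (MulOpposite.op r • ev n) = c (ev (MulOpposite.op r • n))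
  rw [hev]

theorem doubleDualMap_injective : Function.Injective (doubleDualMap (R := R) A) := by
  rw [injective_iff_map_eq_zero]
  intro a ha
  refine CharacterModule.eq_zero_of_character_apply fun c => ?_
  exact DFunLike.congr_fun ha (show LeftDual A from c)

/-- A module is a pure submodule of its double character module. -/
theorem pureShortExact_doubleDualMap :
    PureShortExact (doubleDualMap (R := R) A) (LinearMap.range (doubleDualMap A)).mkQ where
  injective := doubleDualMap_injective
  exact := LinearMap.exact_map_mkQ_range _
  surjective := Submodule.mkQ_surjective _
  tensor_injective _ _ _ := tensor_injective_of_extension exists_extension_doubleDual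
  tensor_exact _ _ _ := tensor_exact (LinearMap.exact_map_mkQ_range _)
    (Submodule.mkQ_surjective _)
  tensor_surjective _ _ _ := tensor_surjective (Submodule.mkQ_surjective _)

/-- A submodule is pure if homomorphisms from it to pure injective modules extend. -/
def IsPure (S : Submodule R A) : Prop :=
  ∀ (E : Type v) [AddCommGroup E] [Module R E], PureInjective R E →
    ∀ φ : S →ₗ[R] E, ∃ ψ : A →ₗ[R] E, ψ ∘ₗ S.subtype = φ

theorem IsPure.pureShortExact {S : Submodule R A} (h : IsPure S) (g : A →ₗ[R] C)
    (hg : Function.Surjective g) (hS : LinearMap.ker g = S) : PureShortExact S.subtype g :=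
  pureShortExact_of_extension S.injective_subtype
    (LinearMap.exact_iff.2 (by rw [hS, Submodule.range_subtype])) hg h

theorem isPure_of_pureShortExact {S : Submodule R A} {g : A →ₗ[R] C}
    (h : PureShortExact S.subtype g) : IsPure S :=
  fun _ _ _ hE φ => hE _ _ _ _ _ h φ

theorem isPure_top : IsPure (⊤ : Submodule R A) := fun _ _ _ _ φ =>
  ⟨φ ∘ₗ LinearMap.codRestrict ⊤ LinearMap.id fun _ => trivial, rfl⟩

theorem isPure_bot : IsPure (⊥ : Submodule R A) := fun _ _ _ _ φ =>
  ⟨0, LinearMap.ext fun x => by rw [Subsingleton.elim x 0, map_zero, map_zero]⟩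

theorem IsPure.of_retraction {S : Submodule R A} (r : A →ₗ[R] S) (hr : r ∘ₗ S.subtype = .id) :
    IsPure S := fun _ _ _ _ φ =>
  ⟨φ ∘ₗ r, by rw [LinearMap.comp_assoc, hr, LinearMap.comp_id]⟩

end

end Duality

/-! ### Pure exactness through kernels and images -/

section PurityOfDifferentials

variable {R : Type w} [Ring R]

/-- The middle object of a decomposition is necessarily the image of `d`, so only the purity of
kernel and image matters. -/
theorem decomposes_iff {A B : ModuleCat.{v} R} (d : A ⟶ B) :
    Decomposes d ↔ IsPure (LinearMap.ker d.hom) ∧ IsPure (LinearMap.range d.hom) := by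
  constructor
  · rintro ⟨D, p, j, hp, hj, h⟩
    have hker : LinearMap.ker p = LinearMap.ker d.hom := by
      rw [← h, LinearMap.ker_comp_of_ker_eq_bot _ (LinearMap.ker_eq_bot.2 hj.injective)]
    have hrange : ∀ x, j x ∈ LinearMap.range d.hom := fun x => by
      obtain ⟨a, rfl⟩ := hp.surjective x
      exact ⟨a, (LinearMap.congr_fun h a).symm⟩
    refine ⟨hker ▸ isPure_of_pureShortExact hp, fun E _ _ hE φ => ?_⟩
    obtain ⟨ψ, hψ⟩ := hE _ _ _ _ _ hj (φ ∘ₗ LinearMap.codRestrict _ j hrange)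
    refine ⟨ψ, LinearMap.ext ?_⟩
    rintro ⟨_, a, rfl⟩
    refine Eq.trans ?_ ((LinearMap.congr_fun hψ (p a)).trans (congrArg φ (Subtype.ext ?_)))
    · exact congrArg ψ (LinearMap.congr_fun h a).symm
    · exact LinearMap.congr_fun h a
  · rintro ⟨hk, hr⟩
    have hk' : IsPure (LinearMap.ker d.hom.rangeRestrict) := by
      rw [LinearMap.ker_rangeRestrict]
      exact hk
    refine ⟨ModuleCat.of R (LinearMap.range d.hom), d.hom.rangeRestrict,
      (LinearMap.range d.hom).subtype,
      hk'.pureShortExact _ d.hom.surjective_rangeRestrict rfl,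
      hr.pureShortExact _ (Submodule.mkQ_surjective _) ?_, rfl⟩
    rw [Submodule.ker_mkQ, Submodule.range_subtype]

/-- Pure exactness in terms of cycles and boundaries. -/
theorem pureExactAt_iff (X : CochainComplex (ModuleCat.{v} R) ℤ) {i j k : ℤ} (hij : i + 1 = j)
    (hjk : j + 1 = k) :
    PureExactAt X j ↔ LinearMap.range (X.d i j).hom = LinearMap.ker (X.d j k).hom ∧
      IsPure (LinearMap.ker (X.d i j).hom) ∧ IsPure (LinearMap.ker (X.d j k).hom) ∧
        IsPure (LinearMap.range (X.d j k).hom) := by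
  obtain rfl : i = j - 1 := by lia
  subst hjk
  rw [PureExactAt, decomposes_iff, decomposes_iff]
  constructor
  · rintro ⟨⟨h1, -⟩, ⟨h2, h3⟩, h4⟩
    refine ⟨?_, h1, h2, h3⟩
    have := LinearMap.exact_iff.1 h4.exact
    rw [Submodule.ker_mkQ, Submodule.range_subtype] at this
    exact this
  · rintro ⟨h0, h1, h2, h3⟩
    refine ⟨⟨h1, h0 ▸ h2⟩, ⟨h2, h3⟩, h2.pureShortExact _ (Submodule.mkQ_surjective _) ?_⟩
    rw [Submodule.ker_mkQ, h0]

theorem PureExact.range_eq_ker {X : CochainComplex (ModuleCat.{v} R) ℤ} (hX : PureExact X)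
    {i j k : ℤ} (hij : i + 1 = j) (hjk : j + 1 = k) :
    LinearMap.range (X.d i j).hom = LinearMap.ker (X.d j k).hom :=
  ((pureExactAt_iff X hij hjk).1 (hX j)).1

theorem PureExact.exists_of_d_eq_zero {X : CochainComplex (ModuleCat.{v} R) ℤ} (hX : PureExact X)
    {i j k : ℤ} (hij : i + 1 = j) (hjk : j + 1 = k) (x : X.X j) (hx : X.d j k x = 0) :
    ∃ y, X.d i j y = x := by
  have : x ∈ LinearMap.ker (X.d j k).hom := hx
  rw [← hX.range_eq_ker hij hjk] at this
  exact this

theorem PureExact.isPure_ker {X : CochainComplex (ModuleCat.{v} R) ℤ} (hX : PureExact X)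
    {j k : ℤ} (hjk : j + 1 = k) : IsPure (LinearMap.ker (X.d j k).hom) :=
  ((pureExactAt_iff X (sub_add_cancel j 1) hjk).1 (hX j)).2.2.1

theorem PureExact.isPure_range {X : CochainComplex (ModuleCat.{v} R) ℤ} (hX : PureExact X)
    {j k : ℤ} (hjk : j + 1 = k) : IsPure (LinearMap.range (X.d j k).hom) :=
  ((pureExactAt_iff X (sub_add_cancel j 1) hjk).1 (hX j)).2.2.2

/-- By exactness each image is the next kernel, so purity of the kernels suffices. -/
theorem pureExact_of {X : CochainComplex (ModuleCat.{v} R) ℤ}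
    (h : ∀ i j k : ℤ, i + 1 = j → j + 1 = k →
      LinearMap.range (X.d i j).hom = LinearMap.ker (X.d j k).hom)
    (h' : ∀ i j : ℤ, i + 1 = j → IsPure (LinearMap.ker (X.d i j).hom)) : PureExact X := fun n =>
  (pureExactAt_iff X (sub_add_cancel n 1) rfl).2
    ⟨h _ _ _ (sub_add_cancel n 1) rfl, h' _ _ (sub_add_cancel n 1), h' _ _ rfl,
      h _ _ _ rfl rfl ▸ h' _ _ rfl⟩

/-- The `ModuleCat` form of extending along a linear map onto its image. -/
theorem ModuleCat.exists_factor_of_isPure_range {A B E : ModuleCat.{v} R} (d : A ⟶ B)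
    (hd : IsPure (LinearMap.range d.hom)) (hE : PureInjective R E) (φ : A ⟶ E)
    (h : ∀ x, d x = 0 → φ x = 0) : ∃ ψ : B ⟶ E, d ≫ ψ = φ := by
  obtain ⟨k, hk⟩ := exists_factor_of_surjective d.hom.surjective_rangeRestrict φ.hom (by
    rw [LinearMap.ker_rangeRestrict]
    exact h)
  obtain ⟨ψ, hψ⟩ := hd E hE k
  refine ⟨ModuleCat.ofHom ψ, ModuleCat.hom_ext (LinearMap.ext fun x => ?_)⟩
  exact (LinearMap.congr_fun hψ (d.hom.rangeRestrict x)).trans (LinearMap.congr_fun hk x)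

theorem PureExact.exists_factor {X : CochainComplex (ModuleCat.{v} R) ℤ} (hX : PureExact X)
    {E : ModuleCat.{v} R} (hE : PureInjective R E) {i j k : ℤ} (hij : i + 1 = j) (hjk : j + 1 = k)
    (φ : X.X j ⟶ E) (h : X.d i j ≫ φ = 0) : ∃ ψ : X.X k ⟶ E, X.d j k ≫ ψ = φ := by
  refine ModuleCat.exists_factor_of_isPure_range _ (hX.isPure_range hjk) hE φ fun x hx => ?_
  obtain ⟨y, rfl⟩ := hX.exists_of_d_eq_zero hij hjk x hx
  exact LinearMap.congr_fun (congrArg ModuleCat.Hom.hom h) y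

/-- The additive family version of `PureExact.exists_factor`. -/
theorem PureExact.exists_additive_factor {X : CochainComplex (ModuleCat.{v} R) ℤ}
    (hX : PureExact X) {E : ModuleCat.{v} R} (hE : AdditivelyPureInjective R E) {i j k : ℤ}
    (hij : i + 1 = j) (hjk : j + 1 = k) {H : Type v} [AddCommGroup H] (φ : H →+ (X.X j ⟶ E))
    (h : ∀ z, X.d i j ≫ φ z = 0) : ∃ ψ : H →+ (X.X k ⟶ E), ∀ z, X.d j k ≫ ψ z = φ z := by
  let p := (X.d j k).hom.rangeRestrict
  have hp : Function.Surjective p := (X.d j k).hom.surjective_rangeRestrict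
  have hφ (z : H) : ∃ κ : LinearMap.range (X.d j k).hom →ₗ[R] E, κ ∘ₗ p = (φ z).hom := by
    refine exists_factor_of_surjective hp _ fun x hx => ?_
    rw [LinearMap.ker_rangeRestrict] at hx
    obtain ⟨y, rfl⟩ := hX.exists_of_d_eq_zero hij hjk x hx
    exact LinearMap.congr_fun (congrArg ModuleCat.Hom.hom (h z)) y
  choose κ hκ using hφ
  have hinj {f g : LinearMap.range (X.d j k).hom →ₗ[R] E} (hfg : f ∘ₗ p = g ∘ₗ p) : f = g :=
    (LinearMap.cancel_right hp).1 hfg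
  obtain ⟨ψ, hψ⟩ := hE _ _ _ _ _ ((hX.isPure_range hjk).pureShortExact _
    (Submodule.mkQ_surjective _) (Submodule.ker_mkQ _)) H
    (AddMonoidHom.mk' κ fun z z' => hinj (by
      rw [LinearMap.add_comp, hκ, hκ, hκ, map_add]
      rfl))
  refine ⟨AddMonoidHom.mk' (fun z => ModuleCat.ofHom (ψ z)) fun z z' => ?_, fun z => ?_⟩
  · rw [map_add]
    rfl
  · refine ModuleCat.hom_ext (LinearMap.ext fun x => ?_)
    exact (LinearMap.congr_fun (hψ z) (p x)).trans (LinearMap.congr_fun (hκ z) x)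

/-- A retract of a pure exact complex is pure exact. -/
theorem PureExact.of_retract {X X' : CochainComplex (ModuleCat.{v} R) ℤ} (hX : PureExact X)
    (i : X' ⟶ X) (p : X ⟶ X') (hip : i ≫ p = 𝟙 X') : PureExact X' := by
  have hpi (n : ℤ) (x : X'.X n) : p.f n (i.f n x) = x := by
    have := HomologicalComplex.congr_hom hip n
    exact LinearMap.congr_fun (congrArg ModuleCat.Hom.hom this) x
  have hd {Y Y' : CochainComplex (ModuleCat.{v} R) ℤ} (f : Y ⟶ Y') (a b : ℤ) (y : Y.X a) :
      f.f b (Y.d a b y) = Y'.d a b (f.f a y) :=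
    LinearMap.congr_fun (congrArg ModuleCat.Hom.hom (f.comm a b).symm) y
  refine pureExact_of (fun a b c hab hbc => le_antisymm ?_ fun x hx => ?_) fun a b hab E _ _ hE φ => ?_
  · rintro _ ⟨x, rfl⟩
    exact LinearMap.congr_fun (congrArg ModuleCat.Hom.hom (X'.d_comp_d a b c)) x
  · obtain ⟨y, hy⟩ := hX.exists_of_d_eq_zero hab hbc (i.f b x) (by
      rw [← hd, show X'.d b c x = 0 from hx, map_zero])
    refine ⟨p.f a y, ?_⟩
    change X'.d a b (p.f a y) = x
    rw [← hd, hy, hpi]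
  · obtain ⟨ψ, hψ⟩ := hX.isPure_ker hab E hE (φ ∘ₗ
      LinearMap.restrict (p.f a).hom (p := LinearMap.ker (X.d a b).hom)
        (q := LinearMap.ker (X'.d a b).hom) fun x hx => by
          change X'.d a b (p.f a x) = 0
          rw [← hd, show X.d a b x = 0 from hx, map_zero])
    refine ⟨ψ ∘ₗ (i.f a).hom, LinearMap.ext fun x => ?_⟩
    have hx : i.f a x.1 ∈ LinearMap.ker (X.d a b).hom := by
      change X.d a b (i.f a x.1) = 0
      rw [← hd, show X'.d a b x.1 = 0 from x.2, map_zero]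
    refine (LinearMap.congr_fun hψ ⟨_, hx⟩).trans (congrArg φ (Subtype.ext ?_))
    exact hpi a x.1

end PurityOfDifferentials

/-! ### Detecting pure exactness by maps into pure injective modules -/

section Detection

variable {R : Type u} [Ring R]

/-- Pure injective modules separate an element from a submodule. -/
theorem exists_pureInjective_separating {A : Type u} [AddCommGroup A] [Module R A]
    (S : Submodule R A) {x : A} (hx : x ∉ S) :
    ∃ (E : ModuleCat.{u} R) (φ : A →ₗ[R] E), PureInjective R E ∧ (∀ y ∈ S, φ y = 0) ∧ φ x ≠ 0 := by
  have hne : S.mkQ x ≠ 0 := fun h0 => hx ((Submodule.Quotient.mk_eq_zero _).1 h0)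
  obtain ⟨c, hc⟩ := CharacterModule.exists_character_apply_ne_zero_of_ne_zero hne
  -- Coinduction: `a ↦ (r ↦ c(r a))`, from which evaluation at `1` recovers `c`. The character
  -- module of `R` itself is needed, so the ring lives in the universe of the modules.
  let φ : A →ₗ[R] RightDual R :=
    { toFun := fun a => show R →+ AddCircle (1 : ℚ) from
        { toFun := fun r => c (S.mkQ (r • a))
          map_zero' := by rw [zero_smul, map_zero, map_zero]
          map_add' := fun r s => by rw [add_smul, map_add, map_add] }
      map_add' := fun a b => RightDual.ext fun r => by
        change c (S.mkQ (r • (a + b))) = c (S.mkQ (r • a)) + c (S.mkQ (r • b))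
        rw [smul_add, map_add, map_add]
      map_smul' := fun s a => RightDual.ext fun r => by
        change c (S.mkQ (r • s • a)) = c (S.mkQ ((r * s) • a))
        rw [mul_smul] }
  refine ⟨ModuleCat.of R (RightDual R), φ, pureInjective_rightDual, fun y hy => ?_, fun h0 => ?_⟩
  · refine RightDual.ext fun r => ?_
    change c (S.mkQ (r • y)) = 0
    rw [show S.mkQ (r • y) = 0 from (Submodule.Quotient.mk_eq_zero _).2 (S.smul_mem r hy),
      map_zero]
  · refine hc ?_
    have : c (S.mkQ ((1 : R) • x)) = 0 := DFunLike.congr_fun h0 (1 : R)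
    rwa [one_smul] at this

/-- Pure exactness is exactness of `Hom(-, E)` for all pure injective modules `E`. -/
theorem pureExact_of_exists_factor {X : CochainComplex (ModuleCat.{u} R) ℤ}
    (h : ∀ (E : ModuleCat.{u} R), PureInjective R E → ∀ i j k : ℤ, i + 1 = j → j + 1 = k →
      ∀ φ : X.X j ⟶ E, X.d i j ≫ φ = 0 → ∃ ψ : X.X k ⟶ E, X.d j k ≫ ψ = φ) : PureExact X := by
  have hex (i j k : ℤ) (hij : i + 1 = j) (hjk : j + 1 = k) :
      LinearMap.range (X.d i j).hom = LinearMap.ker (X.d j k).hom := by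
    refine le_antisymm ?_ fun x hx => ?_
    · rintro _ ⟨x, rfl⟩
      exact LinearMap.congr_fun (congrArg ModuleCat.Hom.hom (X.d_comp_d i j k)) x
    · by_contra hn
      obtain ⟨E, φ, hE, h0, hx'⟩ := exists_pureInjective_separating _ hn
      obtain ⟨ψ, hψ⟩ := h E hE i j k hij hjk (ModuleCat.ofHom φ)
        (ModuleCat.hom_ext (LinearMap.ext fun y => h0 _ ⟨y, rfl⟩))
      have h2 : ψ (X.d j k x) = φ x := LinearMap.congr_fun (congrArg ModuleCat.Hom.hom hψ) x
      rw [show X.d j k x = 0 from hx, map_zero] at h2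
      exact hx' h2.symm
  refine pureExact_of hex fun i j hij E _ _ hE φ => ?_
  obtain ⟨k, rfl⟩ : ∃ k, k + 1 = i := ⟨i - 1, by lia⟩
  have hmem (x : X.X k) : X.d k (k + 1) x ∈ LinearMap.ker (X.d (k + 1) j).hom :=
    LinearMap.congr_fun (congrArg ModuleCat.Hom.hom (X.d_comp_d k (k + 1) j)) x
  -- The kernel is the image of the preceding differential. Composing `φ` with that differential
  -- gives a map killing boundaries, and its factorization through the differential extends `φ`.
  obtain ⟨ψ, hψ⟩ := h (ModuleCat.of R E) hE (k - 1) k (k + 1) (by lia) rfl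
    (ModuleCat.ofHom (φ ∘ₗ LinearMap.codRestrict _ (X.d k (k + 1)).hom hmem)) (by
      refine ModuleCat.hom_ext (LinearMap.ext fun x => ?_)
      refine (congrArg φ (Subtype.ext ?_)).trans (map_zero φ)
      exact LinearMap.congr_fun (congrArg ModuleCat.Hom.hom (X.d_comp_d (k - 1) k (k + 1))) x)
  refine ⟨ψ.hom, LinearMap.ext fun x => ?_⟩
  obtain ⟨x, hx⟩ := x
  have hx' := hx
  rw [← hex k (k + 1) j rfl hij] at hx'
  obtain ⟨y, rfl⟩ := hx'
  exact LinearMap.congr_fun (congrArg ModuleCat.Hom.hom hψ) y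

end Detection

/-! ### Pure quasi-isomorphisms unravelled on the mapping cone -/

section Cone

variable {R : Type u} [Ring R] {X Y : CochainComplex (ModuleCat.{u} R) ℤ} {f : X ⟶ Y}

open CochainComplex

/-- The cone is `X^j ⊕ Y^i` in degree `i`, so a map from it to `E` is a pair `(α, κ)`. The two
equations on the pair say that it kills boundaries, and `(β, γ)` is its factorization through the
differential, with the sign of the cone. -/
theorem PureQuasiIso.exists_factor (hf : PureQuasiIso f) {E : ModuleCat.{u} R}
    (hE : PureInjective R E) {h i j k : ℤ} (hhi : h + 1 = i) (hij : i + 1 = j) (hjk : j + 1 = k)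
    (α : X.X j ⟶ E) (κ : Y.X i ⟶ E) (hκ : Y.d h i ≫ κ = 0) (hα : f.f i ≫ κ = X.d i j ≫ α) :
    ∃ (β : X.X k ⟶ E) (γ : Y.X j ⟶ E), α = f.f j ≫ γ - X.d j k ≫ β ∧ κ = Y.d i j ≫ γ := by
  obtain ⟨ψ, hψ⟩ := PureExact.exists_factor hf hE hhi hij
    ((mappingCone.fst f).1.v i j hij ≫ α + (mappingCone.snd f).v i i (add_zero i) ≫ κ) (by
      rw [mappingCone.ext_from_iff f i h hhi]
      constructor
      · simp [mappingCone.inl_v_d_assoc f i h j (by lia) (by lia), hα]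
      · simp [hκ])
  refine ⟨(mappingCone.inl f).v k j (by lia) ≫ ψ, (mappingCone.inr f).f j ≫ ψ, ?_, ?_⟩
  · have := congrArg (fun φ => (mappingCone.inl f).v j i (by lia) ≫ φ) hψ
    simp only [mappingCone.inl_v_d_assoc f j i k (by lia) (by lia), Preadditive.sub_comp,
      Preadditive.comp_add, Category.assoc] at this
    rw [this]
    simp
  · have := congrArg (fun φ => (mappingCone.inr f).f i ≫ φ) hψ
    simp only [mappingCone.inr_f_d_assoc, Preadditive.comp_add] at this
    rw [this]
    simp

theorem pureQuasiIso_of_exists_factor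
    (h : ∀ (E : ModuleCat.{u} R), PureInjective R E → ∀ (h i j k : ℤ), h + 1 = i → i + 1 = j →
      j + 1 = k → ∀ (α : X.X j ⟶ E) (κ : Y.X i ⟶ E), Y.d h i ≫ κ = 0 →
        f.f i ≫ κ = X.d i j ≫ α →
        ∃ (β : X.X k ⟶ E) (γ : Y.X j ⟶ E), α = f.f j ≫ γ - X.d j k ≫ β ∧ κ = Y.d i j ≫ γ) :
    PureQuasiIso f := by
  refine pureExact_of_exists_factor fun E hE a i j hai hij φ hφ => ?_
  have h1 := congrArg (fun ψ => (mappingCone.inl f).v i a (by lia) ≫ ψ) hφ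
  have h2 := congrArg (fun ψ => (mappingCone.inr f).f a ≫ ψ) hφ
  simp only [mappingCone.inl_v_d_assoc f i a j (by lia) (by lia), Preadditive.sub_comp,
    Category.assoc, comp_zero, sub_eq_zero] at h1
  simp only [mappingCone.inr_f_d_assoc, comp_zero] at h2
  obtain ⟨β, γ, hβ, hγ⟩ := h E hE a i j (j + 1) hai hij rfl
    ((mappingCone.inl f).v j i (by lia) ≫ φ) ((mappingCone.inr f).f i ≫ φ) h2 h1
  refine ⟨(mappingCone.fst f).1.v j (j + 1) rfl ≫ β +
    (mappingCone.snd f).v j j (add_zero j) ≫ γ, ?_⟩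
  rw [mappingCone.ext_from_iff f j i hij]
  constructor
  · rw [hβ]
    simp [mappingCone.inl_v_d_assoc f j i (j + 1) (by lia) (by lia), sub_eq_add_neg, add_comm]
  · rw [hγ]
    simp

/-- Exactness of the cone at the cycle `(0, z)`: the map is surjective on cohomology. -/
theorem PureQuasiIso.exists_of_d_eq_zero (hf : PureQuasiIso f) {i j k : ℤ} (hij : i + 1 = j)
    (hjk : j + 1 = k) (z : Y.X j) (hz : Y.d j k z = 0) :
    ∃ (x : X.X j) (y : Y.X i), X.d j k x = 0 ∧ z = f.f j x + Y.d i j y := by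
  obtain ⟨c, hc⟩ := PureExact.exists_of_d_eq_zero hf hij hjk ((mappingCone.inr f).f j z) (by
    rw [← ConcreteCategory.comp_apply, mappingCone.inr_f_d, ConcreteCategory.comp_apply, hz,
      map_zero])
  refine ⟨(mappingCone.fst f).1.v i j hij c, (mappingCone.snd f).v i i (add_zero i) c, ?_, ?_⟩
  · have := congrArg ((mappingCone.fst f).1.v j k hjk) hc
    rw [← ConcreteCategory.comp_apply, ← ConcreteCategory.comp_apply,
      mappingCone.d_fst_v f i j k hij hjk, mappingCone.inr_f_fst_v] at this
    simpa using this
  · have := congrArg ((mappingCone.snd f).v j j (add_zero j)) hc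
    rw [← ConcreteCategory.comp_apply, ← ConcreteCategory.comp_apply,
      mappingCone.d_snd_v f i j hij, mappingCone.inr_f_snd_v] at this
    simpa using this.symm

/-- Exactness of the cone at the cycle `(x, y)`. It refines injectivity on cohomology by keeping
track of `y`. -/
theorem PureQuasiIso.exists_of_map_eq (hf : PureQuasiIso f) {h i j k : ℤ} (hhi : h + 1 = i)
    (hij : i + 1 = j) (hjk : j + 1 = k) (x : X.X j) (y : Y.X i) (hx : X.d j k x = 0)
    (hxy : f.f j x + Y.d i j y = 0) :
    ∃ (x' : X.X i) (y' : Y.X h), x = - X.d i j x' ∧ y = f.f i x' + Y.d h i y' := by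
  obtain ⟨c, hc⟩ := PureExact.exists_of_d_eq_zero hf hhi hij
    ((mappingCone.inl f).v j i (by lia) x + (mappingCone.inr f).f i y) (by
      rw [map_add, ← ConcreteCategory.comp_apply, ← ConcreteCategory.comp_apply,
        mappingCone.inr_f_d, mappingCone.inl_v_d f j i k (by lia) (by lia)]
      have h2 := congrArg ((mappingCone.inr f).f j) hxy
      simp only [map_add, map_zero] at h2
      simp [hx, h2])
  refine ⟨(mappingCone.fst f).1.v h i hhi c, (mappingCone.snd f).v h h (add_zero h) c, ?_, ?_⟩
  · have := congrArg ((mappingCone.fst f).1.v i j hij) hc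
    rw [map_add, ← ConcreteCategory.comp_apply, ← ConcreteCategory.comp_apply,
      ← ConcreteCategory.comp_apply, mappingCone.d_fst_v f h i j hhi hij,
      mappingCone.inr_f_fst_v, mappingCone.inl_v_fst_v] at this
    simpa using this.symm
  · have := congrArg ((mappingCone.snd f).v i i (add_zero i)) hc
    rw [map_add, ← ConcreteCategory.comp_apply, ← ConcreteCategory.comp_apply,
      ← ConcreteCategory.comp_apply, mappingCone.d_snd_v f h i hhi,
      mappingCone.inr_f_snd_v, mappingCone.inl_v_snd_v] at this
    simpa using this.symm

end Cone

/-! ### Recursive choice over the integers -/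

section Recursion

/-- Dependent choice along the integers, starting from a given sequence below `a`. -/
theorem exists_int_sequence {T : ℤ → Type*} (r : ∀ n, T n → T (n + 1) → Prop) (a : ℤ)
    (x₀ : ∀ n, n ≤ a → T n) (h₀ : ∀ n (hn : n < a), r n (x₀ n hn.le) (x₀ (n + 1) hn))
    (step : ∀ n, a ≤ n → ∀ x : T n, ∃ y, r n x y) :
    ∃ s : ∀ n, T n, (∀ n (hn : n ≤ a), s n = x₀ n hn) ∧ ∀ n, r n (s n) (s (n + 1)) := by
  choose g hg using step
  -- Upward the chosen successor is used; downward the recursion ignores its input and returns the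
  -- given data.
  let s : ∀ n, T n := fun n =>
    Int.inductionOn' (motive := T) n a (x₀ a le_rfl) (fun k hk x => g k hk x)
      (fun k hk _ => x₀ (k - 1) (by lia))
  have hs (n : ℤ) (hn : n ≤ a) : s n = x₀ n hn := by
    rcases hn.eq_or_lt with rfl | hlt
    · exact Int.inductionOn'_self
    · obtain ⟨m, rfl⟩ : ∃ m, n = m - 1 := ⟨n + 1, by lia⟩
      exact Int.inductionOn'_sub_one (by lia)
  refine ⟨s, hs, fun n => ?_⟩
  by_cases hn : n < a
  · rw [hs n hn.le, hs (n + 1) hn]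
    exact h₀ n hn
  · have : s (n + 1) = g n (not_lt.1 hn) (s n) := Int.inductionOn'_add_one (not_lt.1 hn)
    rw [this]
    exact hg _ _ _

end Recursion

/-! ### Hom from a pure exact complex into a bounded below one -/

section HomComplex

variable {R : Type w} [Ring R]

open CochainComplex CochainComplex.HomComplex

/-- If `X` is pure exact and `I` is a bounded below complex of (additively) pure injective modules,
then the cocycles of `Hom(X, I)` are coboundaries, additively in any family. -/
theorem exists_primitive {X I : CochainComplex (ModuleCat.{v} R) ℤ} (hX : PureExact X) {a : ℤ}
    (ha : ∀ i ≤ a, IsZero (I.X i)) (hI : ∀ i, AdditivelyPureInjective R (I.X i)) (m : ℤ)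
    {H : Type v} [AddCommGroup H] (z : H →+ Cochain X I (m + 1)) (hz : ∀ h, δ (m + 1) (m + 2) (z h) = 0) :
    ∃ y : H →+ Cochain X I m, ∀ h, δ m (m + 1) (y h) = z h := by
  -- The sign of the term `d_X ≫ y` in `δ y` for a cochain `y` of degree `m`.
  let ε : ℤˣ := (m + 1).negOnePow
  have hε : ε * ε = 1 := Int.units_mul_self ε
  have hεz (h : H) (p q r : ℤ) (hpq : p + (m + 1) = q) (hr : q + 1 = r) :
      (z h).v p q hpq ≫ I.d q r = ε • X.d p (p + 1) ≫ (z h).v (p + 1) r (by lia) := by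
    have := Cochain.congr_v (hz h) p r (by lia)
    rw [δ_v (m + 1) (m + 2) (by lia) (z h) p r (by lia) q (p + 1) (by lia) rfl,
      Cochain.zero_v, show (m + 2).negOnePow = - (m + 1).negOnePow by
        rw [show m + 2 = m + 1 + 1 by ring, Int.negOnePow_succ], Units.neg_smul,
      add_neg_eq_zero] at this
    exact this
  -- A candidate component of the primitive in degree `n`. The invariant says that the remainder `z
  -- - t ≫ d` kills boundaries, which is exactly what makes the next component exist.
  let T (n : ℤ) : Type v := { t : H →+ (X.X n ⟶ I.X (n + m)) //
    ∀ h k, k + 1 = n → X.d k n ≫ ((z h).v n (n + 1 + m) (by lia) -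
      t h ≫ I.d (n + m) (n + 1 + m)) = 0 }
  let r (n : ℤ) (t : T n) (t' : T (n + 1)) : Prop := ∀ h,
    t.1 h ≫ I.d (n + m) (n + 1 + m) + ε • X.d n (n + 1) ≫ t'.1 h =
      (z h).v n (n + 1 + m) (by lia)
  -- For `n ≤ a - m` the target `I^{n+m}` is zero, so the primitive starts out as `0`.
  obtain ⟨s, -, hs⟩ := exists_int_sequence r (a - m)
    (fun n hn => ⟨0, fun h k hk => by
      subst hk
      have := hεz h k (k + 1 + m) (k + 1 + 1 + m) (by lia) (by lia)
      rw [(ha _ (by lia)).eq_of_tgt ((z h).v k (k + 1 + m) (by lia)) 0, zero_comp] at this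
      have h2 := congrArg (fun φ => ε • φ) this
      simp only [smul_zero, smul_smul, hε, one_smul] at h2
      simp [h2]⟩)
    (fun n hn h => (ha _ (by lia)).eq_of_tgt _ _)
    (fun n hn t => by
      obtain ⟨t', ht'⟩ := hX.exists_additive_factor (hI (n + 1 + m)) (sub_add_cancel n 1) rfl
        (AddMonoidHom.mk' (fun h => ε • ((z h).v n (n + 1 + m) (by lia) -
          t.1 h ≫ I.d (n + m) (n + 1 + m))) fun h h' => by
            rw [map_add, map_add, Cochain.add_v, Preadditive.add_comp, ← smul_add]
            congr 1
            abel)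
        (fun h => by
          rw [AddMonoidHom.mk'_apply, Linear.comp_units_smul, t.2 h _ (sub_add_cancel n 1),
            smul_zero])
      refine ⟨⟨t', fun h k hk => ?_⟩, fun h => ?_⟩
      · obtain rfl : k = n := by lia
        have := hεz h k (k + 1 + m) (k + 1 + 1 + m) (by lia) (by lia)
        have h2 := congrArg (fun φ => ε • φ) this
        simp only [smul_smul, hε, one_smul] at h2
        rw [Preadditive.comp_sub, ← h2, ← Category.assoc, ht', AddMonoidHom.mk'_apply]
        simp
      · rw [ht', AddMonoidHom.mk'_apply, smul_smul, hε, one_smul, add_sub_cancel])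
  refine ⟨AddMonoidHom.mk' (fun h => Cochain.mk fun p q hpq => (s p).1 h ≫
    (I.XIsoOfEq (show p + m = q from hpq)).hom) fun h h' => ?_, fun h => ?_⟩
  · ext p q hpq
    rw [Cochain.add_v, Cochain.mk_v, Cochain.mk_v, Cochain.mk_v, map_add, Preadditive.add_comp]
  · refine Cochain.ext _ _ fun p q hpq => ?_
    obtain rfl : q = p + 1 + m := by lia
    rw [δ_v m (m + 1) rfl _ p (p + 1 + m) hpq (p + m) (p + 1) (by lia) rfl,
      AddMonoidHom.mk'_apply, Cochain.mk_v, Cochain.mk_v]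
    simpa using hs p h

theorem exists_linear_primitive {X I : CochainComplex (ModuleCat.{v} R) ℤ} (hX : PureExact X)
    {a : ℤ} (ha : ∀ i ≤ a, IsZero (I.X i)) (hI : ∀ i, AdditivelyPureInjective R (I.X i)) (m : ℤ) :
    ∃ y : LinearMap.ker (δ_hom ℤ X I (m + 1) (m + 2)) →ₗ[ℤ] Cochain X I m,
      ∀ z, δ m (m + 1) (y z) = z := by
  obtain ⟨y, hy⟩ := exists_primitive hX ha hI m
    (LinearMap.ker (δ_hom ℤ X I (m + 1) (m + 2))).subtype.toAddMonoidHom fun z => z.2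
  exact ⟨y.toIntLinearMap, hy⟩

theorem pureExact_homComplex {X I : CochainComplex (ModuleCat.{v} R) ℤ} (hX : PureExact X)
    {a : ℤ} (ha : ∀ i ≤ a, IsZero (I.X i)) (hI : ∀ i, AdditivelyPureInjective R (I.X i)) :
    PureExact (homComplex X I) := by
  refine pureExact_of (fun i j k hij hjk => le_antisymm ?_ ?_) fun i j hij => ?_
  · rintro _ ⟨x, rfl⟩
    exact δ_δ i j k x
  · subst hij
    obtain rfl : k = i + 2 := by lia
    intro z hz
    obtain ⟨y, hy⟩ := exists_linear_primitive hX ha hI i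
    exact ⟨y ⟨z, hz⟩, hy ⟨z, hz⟩⟩
  · subst hij
    obtain ⟨y, hy⟩ := exists_linear_primitive hX ha hI i
    -- The linear map `c ↦ c - y(δ c)` retracts cochains onto cocycles, so these are a direct
    -- summand and hence pure. Primitives chosen one at a time would give only exactness.
    let D : Cochain X I i →ₗ[ℤ] LinearMap.ker (δ_hom ℤ X I (i + 1) (i + 2)) :=
      LinearMap.codRestrict _ (δ_hom ℤ X I i (i + 1)) fun c => δ_δ i (i + 1) (i + 2) c
    refine IsPure.of_retraction (LinearMap.codRestrict _ ((LinearMap.id : Cochain X I i →ₗ[ℤ] _) - y ∘ₗ D)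
      fun (c : Cochain X I i) => ?_) (LinearMap.ext fun c => Subtype.ext ?_)
    · change δ i (i + 1) (c - y (D c)) = 0
      rw [δ_sub, hy, sub_eq_zero]
      rfl
    · change (show Cochain X I i from c.1) - y (D c.1) = c.1
      rw [show D c.1 = 0 from Subtype.ext c.2, map_zero, sub_zero]

end HomComplex

/-! ### Construction of bounded below pure injective resolutions -/

section Resolution

variable {R : Type u} [Ring R]

/-- The part in one degree of a pure injective resolution of `B`: a module with the submodule of
boundaries and a map from `B`. -/
structure ResolutionStage (M : ModuleCat.{u} R) where
  obj : ModuleCat.{u} R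
  boundaries : Submodule R obj
  map : M ⟶ obj
  additivelyPureInjective : AdditivelyPureInjective R obj

/-- Consecutive parts of a pure injective resolution. -/
def ResolutionStage.Step {M M' : ModuleCat.{u} R} (f : M ⟶ M') (S : ResolutionStage M)
    (S' : ResolutionStage M') (d : S.obj ⟶ S'.obj) : Prop :=
  LinearMap.range d.hom = S'.boundaries ∧ S.boundaries ≤ LinearMap.ker d.hom ∧
    S.map ≫ d = f ≫ S'.map ∧
    ∀ (E : ModuleCat.{u} R), PureInjective R E → ∀ (κ : S.obj ⟶ E) (α : M' ⟶ E),
      S.boundaries ≤ LinearMap.ker κ.hom → S.map ≫ κ = f ≫ α →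
        ∃ γ : S'.obj ⟶ E, κ = d ≫ γ ∧ α = S'.map ≫ γ

/-- The quotient `P` is the pushout of `S.obj / boundaries` and `M'` under `M`, and the next term is
`P⁺⁺`. A compatible pair `(κ, α)` is a map out of `P`, which extends to `P⁺⁺` along the pure
embedding. -/
theorem ResolutionStage.exists_step {M M' : ModuleCat.{u} R} (f : M ⟶ M')
    (S : ResolutionStage M) : ∃ (S' : ResolutionStage M') (d : S.obj ⟶ S'.obj), S.Step f S' d := by
  let W : Submodule R (S.obj × M') :=
    S.boundaries.map (LinearMap.inl R S.obj M') ⊔ LinearMap.range (S.map.hom.prod (-f.hom))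
  let P := (S.obj × M') ⧸ W
  let ι := doubleDualMap (R := R) P
  let J := RightDual (LeftDual P)
  let d : S.obj →ₗ[R] J := ι ∘ₗ W.mkQ ∘ₗ LinearMap.inl R S.obj M'
  have hW (x : S.obj × M') (hx : x ∈ W) : W.mkQ x = 0 := (Submodule.Quotient.mk_eq_zero _).2 hx
  refine ⟨⟨ModuleCat.of R J, LinearMap.range d, ModuleCat.ofHom (ι ∘ₗ W.mkQ ∘ₗ LinearMap.inr R _ _),
    additivelyPureInjective_rightDual⟩, ModuleCat.ofHom d, rfl, fun x hx => ?_, ?_, ?_⟩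
  · change ι (W.mkQ (x, 0)) = 0
    rw [hW (x, 0) (Submodule.mem_sup_left ⟨x, hx, rfl⟩), map_zero]
  · refine ModuleCat.hom_ext (LinearMap.ext fun x => ?_)
    change ι (W.mkQ (S.map x, 0)) = ι (W.mkQ (0, f x))
    rw [← sub_eq_zero, ← map_sub, ← map_sub, hW, map_zero]
    refine Submodule.mem_sup_right ⟨x, ?_⟩
    simp
  · intro E hE κ α hκ h
    have hle : W ≤ LinearMap.ker (κ.hom.coprod α.hom) := by
      refine sup_le ?_ ?_
      · rintro _ ⟨x, hx, rfl⟩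
        have : κ x = 0 := hκ hx
        simp [this]
      · rintro _ ⟨x, rfl⟩
        have : κ (S.map x) = α (f x) := LinearMap.congr_fun (congrArg ModuleCat.Hom.hom h) x
        simp [this]
    obtain ⟨γ, hγ⟩ := hE _ _ _ _ _ pureShortExact_doubleDualMap (W.liftQ _ hle)
    refine ⟨ModuleCat.ofHom γ, ModuleCat.hom_ext (LinearMap.ext fun x => ?_),
      ModuleCat.hom_ext (LinearMap.ext fun x => ?_)⟩
    · refine Eq.trans ?_ (LinearMap.congr_fun hγ (W.mkQ (x, 0))).symm
      simp
    · refine Eq.trans ?_ (LinearMap.congr_fun hγ (W.mkQ (0, x))).symm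
      simp

/-- A bounded below complex has a bounded below pure injective resolution. -/
theorem exists_resolution_of_boundedBelow (B : CochainComplex (ModuleCat.{u} R) ℤ) (a : ℤ)
    (hB : ∀ i < a, IsZero (B.X i)) :
    ∃ (I : CochainComplex (ModuleCat.{u} R) ℤ) (f : B ⟶ I), IsPureInjectiveResolution f := by
  -- Zero modules are used up to degree `a - 1`, where `B` vanishes too, so the step condition is
  -- trivial there.
  obtain ⟨s, hs₀, hs⟩ := exists_int_sequence (T := fun n => ResolutionStage (B.X n))
    (fun n S S' => ∃ d, S.Step (B.d n (n + 1)) S' d) (a - 1)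
    (fun n _ => ⟨ModuleCat.of R PUnit, ⊥, 0, additivelyPureInjective_of_subsingleton _⟩)
    (fun n hn => ⟨0, Subsingleton.elim _ _, fun x _ => rfl, rfl, fun E hE κ α _ _ =>
      ⟨0, (ModuleCat.isZero_of_subsingleton (ModuleCat.of R PUnit)).eq_of_src _ _,
        (hB _ (by lia)).eq_of_src _ _⟩⟩)
    (fun n _ S => S.exists_step _)
  choose d hd using hs
  let I : CochainComplex (ModuleCat.{u} R) ℤ := CochainComplex.of (fun n => (s n).obj) d
    fun n => ModuleCat.hom_ext (LinearMap.ext fun x =>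
      (hd (n + 1)).2.1 ((hd n).1 ▸ LinearMap.mem_range_self _ x))
  have hId (n : ℤ) : I.d n (n + 1) = d n := 
    CochainComplex.of_d (fun n => (s n).obj) d n
  let f : B ⟶ I :=
    { f := fun n => (s n).map
      comm' := fun i j hij => by
        obtain rfl : i + 1 = j := hij
        rw [hId]
        exact (hd i).2.2.1 }
  have hI (i : ℤ) : AdditivelyPureInjective R (I.X i) := (s i).additivelyPureInjective
  have ha (i : ℤ) (hi : i ≤ a - 1) : IsZero (I.X i) := by
    change IsZero (s i).obj
    rw [hs₀ i hi]
    exact ModuleCat.isZero_of_subsingleton _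
  refine ⟨I, f, ?_, fun i => (hI i).pureInjective, fun X hX => pureExact_homComplex hX ha hI⟩
  refine pureQuasiIso_of_exists_factor fun E hE h i j k hhi hij _ α κ hκ hα => ?_
  subst hhi hij
  obtain ⟨γ, h₁, h₂⟩ := (hd (h + 1)).2.2.2 E hE κ α (by
    rw [← (hd h).1]
    rintro _ ⟨x, rfl⟩
    rw [hId] at hκ
    exact LinearMap.congr_fun (congrArg ModuleCat.Hom.hom hκ) x) hα
  -- The last clause of `ResolutionStage.Step` is the factorization criterion on the cone, already
  -- with `β = 0`.
  refine ⟨0, γ, ?_, ?_⟩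
  · rw [h₂, comp_zero, sub_zero]
  · rw [hId]
    exact h₁

end Resolution

/-! ### Pure acyclic complexes and orthogonality in the homotopy category -/

section HomotopyCategory

open CochainComplex CochainComplex.HomComplex Pretriangulated

variable (R : Type u) [Ring R]

/-- The stalk complexes of pure injective modules in the homotopy category. -/
def pureInjectiveStalks :
    ObjectProperty (HomotopyCategory (ModuleCat.{u} R) (ComplexShape.up ℤ)) := fun K =>
  ∃ (n : ℤ) (E : ModuleCat.{u} R), PureInjective R E ∧
    Nonempty (K ≅ (HomotopyCategory.singleFunctor (ModuleCat.{u} R) n).obj E)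

instance : (pureInjectiveStalks R).IsStableUnderShift ℤ where
  isStableUnderShiftBy n := ⟨by
    rintro K ⟨m, E, hE, ⟨e⟩⟩
    exact ⟨m - n, E, hE, ⟨(CategoryTheory.shiftFunctor _ n).mapIso e ≪≫
      ((HomotopyCategory.singleFunctors (ModuleCat.{u} R)).shiftIso n (m - n) m (by lia)).app E⟩⟩⟩

/-- The complexes that are pure exact, as a triangulated subcategory of the homotopy category. -/
abbrev pureAcyclic : ObjectProperty (HomotopyCategory (ModuleCat.{u} R) (ComplexShape.up ℤ)) :=
  (pureInjectiveStalks R).leftOrthogonal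

variable {R}

/-- A chain map from `X` to `E` placed in degree `j` is a map `X^j → E` killing boundaries. It is
null-homotopic exactly when it factors through `d^j`, so orthogonality is the detection criterion
for pure exactness. -/
theorem pureAcyclic_quotient_iff (X : CochainComplex (ModuleCat.{u} R) ℤ) :
    pureAcyclic R ((HomotopyCategory.quotient _ _).obj X) ↔ PureExact X := by
  constructor
  · intro h
    refine pureExact_of_exists_factor fun E hE i j k hij hjk φ hφ => ?_
    let z : Cocycle X ((singleFunctor (ModuleCat.{u} R) j).obj E) 0 :=
      Cocycle.toSingleMk φ (add_zero j) i hij hφ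
    have h0 := h ((HomotopyCategory.quotient _ _).map (Cocycle.homOf z))
      ⟨j, E, hE, ⟨Iso.refl _⟩⟩
    rw [HomotopyCategory.quotient_map_eq_zero_iff] at h0
    obtain ⟨γ, hγ⟩ := Cochain.equivHomotopy _ _ h0.some
    rw [Cochain.ofHom_zero, add_zero, Cocycle.cochain_ofHom_homOf_eq_coe] at hγ
    exact (Cocycle.toSingleMk_mem_coboundaries_iff φ (add_zero j) i hij hφ k hjk).1
      ((mem_coboundaries_iff _ (-1) (by lia)).2 ⟨γ, hγ.symm⟩)
  · rintro hX K f ⟨n, E, hE, ⟨e⟩⟩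
    obtain ⟨φ, hφ⟩ := (HomotopyCategory.quotient (ModuleCat.{u} R) (ComplexShape.up ℤ)).map_surjective
      (X := X) (Y := (singleFunctor (ModuleCat.{u} R) n).obj E) (f ≫ e.hom)
    suffices h : f ≫ e.hom = 0 by
      rw [← cancel_mono e.hom, h, zero_comp]
    obtain ⟨ψ, hψ, h⟩ := Cocycle.toSingleMk_surjective (Cocycle.ofHom φ) n (add_zero n) (n - 1)
      (sub_add_cancel n 1)
    obtain ⟨γ, hγ⟩ := (mem_coboundaries_iff _ (-1) (by lia)).1
      ((Cocycle.toSingleMk_mem_coboundaries_iff ψ (add_zero n) (n - 1) (sub_add_cancel n 1) hψ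
        (n + 1) rfl).2 (hX.exists_factor hE (sub_add_cancel n 1) rfl ψ hψ))
    rw [h] at hγ
    refine hφ.symm.trans ((HomotopyCategory.quotient_map_eq_zero_iff _).2
      ⟨(Cochain.equivHomotopy φ 0).symm ⟨γ, ?_⟩⟩)
    rw [hγ, Cochain.ofHom_zero, add_zero]
    rfl

theorem pureQuasiIso_iff_trW {X Y : CochainComplex (ModuleCat.{u} R) ℤ} (f : X ⟶ Y) :
    PureQuasiIso f ↔ (pureAcyclic R).trW ((HomotopyCategory.quotient _ _).map f) := by
  rw [PureQuasiIso, ← pureAcyclic_quotient_iff]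
  exact ((pureAcyclic R).trW_iff_of_distinguished _
    (HomotopyCategory.mappingCone_triangleh_distinguished f)).symm

/-- The octahedral axiom puts the cones of `f`, `f ≫ g` and `g` in a distinguished triangle; two of
them lie in `P`. -/
theorem trW_of_trW_comp {C : Type*} [Category* C] [HasZeroObject C] [HasShift C ℤ]
    [Preadditive C] [∀ n : ℤ, (CategoryTheory.shiftFunctor C n).Additive] [Pretriangulated C] [IsTriangulated C]
    (P : ObjectProperty C) [P.IsTriangulated] [P.IsClosedUnderIsomorphisms] {X Y Z : C}
    {f : X ⟶ Y} {g : Y ⟶ Z} (hf : P.trW f) (hfg : P.trW (f ≫ g)) : P.trW g := by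
  obtain ⟨K, _, _, hK, hPK⟩ := hf
  obtain ⟨L, _, _, hL, hPL⟩ := hfg
  obtain ⟨M, _, _, hM⟩ := distinguished_cocone_triangle g
  exact ⟨M, _, _, hM, P.ext_of_isTriangulatedClosed₃ _ (Triangulated.someOctahedron rfl hK hM hL).mem hPK hPL⟩

/-- A chain map is a `0`-cocycle of the Hom complex, and a primitive of it is a null-homotopy. -/
theorem rightOrthogonal_of_hom_preserves {I : CochainComplex (ModuleCat.{u} R) ℤ}
    (hI : ∀ X : CochainComplex (ModuleCat.{u} R) ℤ, PureExact X → PureExact (homComplex X I)) :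
    (pureAcyclic R).rightOrthogonal ((HomotopyCategory.quotient _ _).obj I) := by
  intro K f hK
  obtain ⟨X, rfl⟩ := HomotopyCategory.quotient_obj_surjective K
  obtain ⟨φ, rfl⟩ := (HomotopyCategory.quotient _ _).map_surjective f
  rw [pureAcyclic_quotient_iff] at hK
  obtain ⟨γ, hγ⟩ := (hI X hK).exists_of_d_eq_zero (i := -1) (j := 0) (k := 1) (by lia) (by lia)
    (Cochain.ofHom φ) (δ_ofHom φ)
  refine (HomotopyCategory.quotient_map_eq_zero_iff _).2
    ⟨(Cochain.equivHomotopy φ 0).symm ⟨γ, ?_⟩⟩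
  rw [Cochain.ofHom_zero, add_zero]
  exact hγ.symm

/-- Maps into a complex that is injective relative to pure exact complexes extend along pure
quasi-isomorphisms, uniquely up to homotopy. -/
theorem PureQuasiIso.bijective_comp {X Y I : CochainComplex (ModuleCat.{u} R) ℤ} {f : X ⟶ Y}
    (hf : PureQuasiIso f)
    (hI : ∀ X : CochainComplex (ModuleCat.{u} R) ℤ, PureExact X → PureExact (homComplex X I)) :
    Function.Bijective fun g : (HomotopyCategory.quotient _ _).obj Y ⟶
      (HomotopyCategory.quotient _ _).obj I => (HomotopyCategory.quotient _ _).map f ≫ g := by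
  have h := rightOrthogonal_of_hom_preserves hI
  rw [← ObjectProperty.isLocal_trW] at h
  exact h _ ((pureQuasiIso_iff_trW f).1 hf)

theorem PureQuasiIso.comp_of_isIso {X Y Z : CochainComplex (ModuleCat.{u} R) ℤ} {f : X ⟶ Y}
    (hf : PureQuasiIso f) (g : Y ⟶ Z) [IsIso ((HomotopyCategory.quotient _ _).map g)] :
    PureQuasiIso (f ≫ g) := by
  rw [pureQuasiIso_iff_trW] at hf ⊢
  rw [Functor.map_comp]
  exact MorphismProperty.RespectsIso.postcomp _ _ _ hf

/-- Every object of the bounded pure derived category has a pure injective resolution. -/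
theorem exists_resolution {Y : CochainComplex (ModuleCat.{u} R) ℤ} (hY : InDbpur Y) :
    ∃ (I : CochainComplex (ModuleCat.{u} R) ℤ) (f : Y ⟶ I), IsPureInjectiveResolution f := by
  obtain ⟨B, ⟨a, b, hB⟩, Z, s, t, hs, ht⟩ := hY
  obtain ⟨I, f, hf⟩ := exists_resolution_of_boundedBelow B a fun i hi => hB i (Or.inl hi)
  -- The composite `Z ⟶ B ⟶ I` extends, up to homotopy, along the leg `Z ⟶ Y` of the roof.
  obtain ⟨g, hg⟩ := (hs.bijective_comp hf.hom_preserves).2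
    ((HomotopyCategory.quotient _ _).map (t ≫ f))
  obtain ⟨g, rfl⟩ := (HomotopyCategory.quotient _ _).map_surjective g
  refine ⟨I, g, ?_, hf.pureInjective, hf.hom_preserves⟩
  rw [pureQuasiIso_iff_trW] at hs ht ⊢
  refine trW_of_trW_comp _ hs ?_
  dsimp only at hg
  rw [hg, Functor.map_comp]
  exact (pureAcyclic R).trW.comp_mem _ _ ht ((pureQuasiIso_iff_trW f).1 hf.pureQuasiIso)

/-- A pure injective resolution is a retract, up to homotopy, of any other one. -/
theorem IsPureInjectiveResolution.exists_homotopy {Y I I' : CochainComplex (ModuleCat.{u} R) ℤ}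
    {f : Y ⟶ I} {f' : Y ⟶ I'} (hf : IsPureInjectiveResolution f)
    (hf' : IsPureInjectiveResolution f') :
    ∃ (g : I ⟶ I') (g' : I' ⟶ I), Nonempty (Homotopy (𝟙 I') (g' ≫ g)) := by
  obtain ⟨g, hg⟩ := (hf.pureQuasiIso.bijective_comp hf'.hom_preserves).2
    ((HomotopyCategory.quotient _ _).map f')
  obtain ⟨g, rfl⟩ := (HomotopyCategory.quotient _ _).map_surjective g
  obtain ⟨g', hg'⟩ := (hf'.pureQuasiIso.bijective_comp hf.hom_preserves).2
    ((HomotopyCategory.quotient _ _).map f)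
  obtain ⟨g', rfl⟩ := (HomotopyCategory.quotient _ _).map_surjective g'
  refine ⟨g, g', ⟨HomotopyCategory.homotopyOfEq _ _ ?_⟩⟩
  -- Both maps agree after precomposition with `f'`, which is injective on homotopy classes into
  -- `I'`.
  refine (hf'.pureQuasiIso.bijective_comp hf'.hom_preserves).1 ?_
  dsimp only at hg hg' ⊢
  rw [Functor.map_comp, reassoc_of% hg', hg, CategoryTheory.Functor.map_id, Category.comp_id]

end HomotopyCategory

/-! ### Contraction above `n` and splitting off a contractible summand -/

section SplitAbove

open CochainComplex CochainComplex.HomComplex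

/-- The identity of `I` is null-homotopic in degrees `> n`. -/
def SplitAbove {R : Type u} [Ring R] (I : CochainComplex (ModuleCat.{u} R) ℤ) (n : ℤ) : Prop :=
  ∃ h : Cochain I I (-1), ∀ m, n < m → (δ (-1) 0 h).v m m (add_zero m) = 𝟙 (I.X m)

variable {R : Type u} [Ring R]

theorem splitAbove_of_homotopy {I J : CochainComplex (ModuleCat.{u} R) ℤ} {n : ℤ} {g : J ⟶ I}
    {g' : I ⟶ J} (h : Homotopy (𝟙 I) (g' ≫ g)) (hJ : ∀ i, n < i → IsZero (J.X i)) :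
    SplitAbove I n := by
  refine ⟨Cochain.ofHomotopy h, fun m hm => ?_⟩
  rw [δ_ofHomotopy, Cochain.sub_v, Cochain.ofHom_v, Cochain.ofHom_v, HomologicalComplex.comp_f,
    (hJ m hm).eq_of_src (g.f m) 0, comp_zero, sub_zero, HomologicalComplex.id_f]

theorem δ_neg_one_v {I : CochainComplex (ModuleCat.{u} R) ℤ} (h : Cochain I I (-1)) {l m k : ℤ}
    (hlm : l + 1 = m) (hmk : m + 1 = k) : (δ (-1) 0 h).v m m (add_zero m) =
      h.v m l (by lia) ≫ I.d l m + I.d m k ≫ h.v k m (by lia) := by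
  rw [δ_v (-1) 0 (by lia) h m m (add_zero m) l k (by lia) hmk, Int.negOnePow_zero, one_smul]

theorem SplitAbove.d_comp_comp_d {I : CochainComplex (ModuleCat.{u} R) ℤ} {n : ℤ}
    {h : Cochain I I (-1)} (hh : ∀ m, n < m → (δ (-1) 0 h).v m m (add_zero m) = 𝟙 (I.X m)) {k : ℤ}
    (hk : n + 1 = k) : I.d n k ≫ h.v k n (by lia) ≫ I.d n k = I.d n k := by
  have := hh k (by lia)
  rw [δ_neg_one_v h hk rfl] at this
  have h2 := congrArg (fun φ => I.d n k ≫ φ) this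
  simpa using h2

/-- Here `X₂` is the image of `p` and `X₁` that of `1 - p`. -/
theorem exists_iso_biprod_of_idempotent {C : Type*} [Category* C] [Preadditive C]
    [IsIdempotentComplete C] [HasBinaryBiproducts C] {X : C} (p : X ⟶ X) (hp : p ≫ p = p) :
    ∃ (X₁ X₂ : C) (e : X ≅ X₁ ⊞ X₂), biprod.inr ≫ e.inv ≫ p = biprod.inr ≫ e.inv ∧
      p ≫ e.hom ≫ biprod.snd = e.hom ≫ biprod.snd ∧ biprod.inl ≫ e.inv ≫ p = 0 := by
  obtain ⟨X₂, i₂, e₂, h₂, h₂'⟩ := IsIdempotentComplete.idempotents_split X p hp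
  obtain ⟨X₁, i₁, e₁, h₁, h₁'⟩ := IsIdempotentComplete.idempotents_split X (𝟙 X - p) (by
    simp [hp])
  have h12 : i₁ ≫ e₂ = 0 := by
    have : i₁ ≫ (e₁ ≫ i₁) ≫ (e₂ ≫ i₂) ≫ e₂ = 0 := by
      rw [h₁', h₂']
      simp only [← Category.assoc]
      simp [hp]
    simpa [reassoc_of% h₁, h₂] using this
  have h21 : i₂ ≫ e₁ = 0 := by
    have : i₂ ≫ (e₂ ≫ i₂) ≫ (e₁ ≫ i₁) ≫ e₁ = 0 := by
      rw [h₁', h₂']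
      simp only [← Category.assoc]
      simp [hp]
    simpa [reassoc_of% h₂, h₁] using this
  refine ⟨X₁, X₂, ⟨biprod.lift e₁ e₂, biprod.desc i₁ i₂, ?_, ?_⟩, ?_, ?_, ?_⟩
  · rw [biprod.lift_desc, h₁', h₂', sub_add_cancel]
  · ext <;> simp [h₁, h₂, h12, h21]
  · simp [← h₂', reassoc_of% h₂]
  · simp [← h₂', h₂]
  · simp [← h₂', reassoc_of% h12]

/-- A complex whose identity is null-homotopic in degrees `> n` is the sum of a complex vanishing
in these degrees and a contractible complex. -/
theorem SplitAbove.exists_iso_biprod {I : CochainComplex (ModuleCat.{u} R) ℤ} {n : ℤ}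
    (hI : SplitAbove I n) : ∃ I₁ I₂ : CochainComplex (ModuleCat.{u} R) ℤ, Nonempty (I ≅ I₁ ⊞ I₂) ∧
      (∀ i : ℤ, n < i → IsZero (I₁.X i)) ∧ Contractible I₂ := by
  obtain ⟨h, hh⟩ := hI
  -- With `h` cut off, `N = δ h'` is `1` above `n`, `0` below `n`, and `h ∘ d` in degree `n`.
  let h' : Cochain I I (-1) := Cochain.mk fun p q hpq => if n < p then h.v p q hpq else 0
  have hpos {p q : ℤ} (hpq : p + (-1) = q) (hp : n < p) : h'.v p q hpq = h.v p q hpq := by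
    rw [Cochain.mk_v, if_pos hp]
  have hneg {p q : ℤ} (hpq : p + (-1) = q) (hp : p ≤ n) : h'.v p q hpq = 0 := by
    rw [Cochain.mk_v, if_neg (not_lt.2 hp)]
  let N : I ⟶ I := Cocycle.homOf (Cocycle.mk (δ (-1) 0 h') 1 (zero_add 1) (δ_δ _ _ _ _))
  have hN (m : ℤ) : N.f m = (δ (-1) 0 h').v m m (add_zero m) := rfl
  have hN₁ (m : ℤ) (hm : n < m) : N.f m = 𝟙 _ := by
    rw [hN, δ_neg_one_v h' (sub_add_cancel m 1) rfl, hpos (q := m - 1) (by omega) hm,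
      hpos (p := m + 1) (q := m) (by omega) (by omega),
      ← δ_neg_one_v h (sub_add_cancel m 1) rfl, hh m hm]
  have hN₂ (m : ℤ) (hm : m < n) : N.f m = 0 := by
    rw [hN, δ_neg_one_v h' (sub_add_cancel m 1) rfl, hneg (q := m - 1) (by omega) hm.le,
      hneg (p := m + 1) (q := m) (by omega) (by omega)]
    simp
  have hNN : N ≫ N = N := by
    ext m : 1
    rw [HomologicalComplex.comp_f]
    rcases lt_trichotomy m n with hm | rfl | hm
    · rw [hN₂ m hm, comp_zero]
    -- In the boundary degree `h d` is idempotent because `d h d = d`.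
    · rw [hN, δ_neg_one_v h' (sub_add_cancel m 1) rfl, hneg (q := m - 1) (by omega) le_rfl,
        hpos (p := m + 1) (q := m) (by omega) (by omega), zero_comp,
        zero_add, Category.assoc, ← Category.assoc (h.v _ _ _), ← Category.assoc,
        SplitAbove.d_comp_comp_d hh rfl]
    · rw [hN₁ m hm, Category.comp_id]
  have hN₀ : Homotopy N 0 := (Cochain.equivHomotopy N 0).symm ⟨h', by
    rw [Cochain.ofHom_zero, add_zero]
    exact Cocycle.cochain_ofHom_homOf_eq_coe _⟩
  obtain ⟨I₁, I₂, e, h₁, h₂, h₃⟩ := exists_iso_biprod_of_idempotent N hNN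
  refine ⟨I₁, I₂, ⟨e⟩, fun i hi => ?_, ⟨?_⟩⟩
  -- `N` acts as zero on `I₁`, but it is the identity above `n`.
  · rw [IsZero.iff_id_eq_zero]
    have h4 : (biprod.inl ≫ e.inv) ≫ e.hom ≫ biprod.fst = 𝟙 I₁ := by simp
    have h5 := HomologicalComplex.congr_hom h₃ i
    rw [← Category.assoc, HomologicalComplex.comp_f, hN₁ i hi, Category.comp_id] at h5
    have h6 := HomologicalComplex.congr_hom h4 i
    rw [HomologicalComplex.comp_f, h5, HomologicalComplex.zero_f, zero_comp,
      HomologicalComplex.id_f] at h6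
    exact h6.symm
  · refine (Homotopy.ofEq ?_).trans
      (((hN₀.compLeft (biprod.inr ≫ e.inv)).compRight (e.hom ≫ biprod.snd)).trans
        (Homotopy.ofEq ?_))
    · simp only [Category.assoc]
      rw [h₂]
      simp
    · simp

/-- Postcomposition with a morphism, as a morphism of Hom complexes. -/
def homComplexMap (X : CochainComplex (ModuleCat.{u} R) ℤ) {I J : CochainComplex (ModuleCat.{u} R) ℤ}
    (g : I ⟶ J) : homComplex X I ⟶ homComplex X J where
  f n := ModuleCat.ofHom
    { toFun := fun c : Cochain X I n => (c.comp (Cochain.ofHom g) (add_zero n) : Cochain X J n)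
      map_add' := fun c c' => Cochain.add_comp c c' _ _
      map_smul' := fun k c => Cochain.smul_comp k c _ _ }
  comm' i j _ := ModuleCat.hom_ext (LinearMap.ext fun c : Cochain X I i => δ_comp_ofHom c g j)

/-- The part of a pure injective resolution complementary to a contractible summand is a pure
injective resolution. -/
theorem IsPureInjectiveResolution.comp_fst {Y I I₁ I₂ : CochainComplex (ModuleCat.{u} R) ℤ}
    {f : Y ⟶ I} (hf : IsPureInjectiveResolution f) (e : I ≅ I₁ ⊞ I₂) (h₂ : Contractible I₂) :
    IsPureInjectiveResolution (f ≫ e.hom ≫ biprod.fst) := by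
  have hip : (biprod.inl ≫ e.inv) ≫ e.hom ≫ biprod.fst = 𝟙 I₁ := by simp
  refine ⟨?_, fun i => ?_, fun X hX => ?_⟩
  · have : IsIso ((HomotopyCategory.quotient _ _).map (e.hom ≫ biprod.fst)) := by
      refine ⟨(HomotopyCategory.quotient _ _).map (biprod.inl ≫ e.inv), ?_, ?_⟩
      · rw [← Functor.map_comp, ← CategoryTheory.Functor.map_id]
        refine (HomotopyCategory.eq_of_homotopy _ _ ?_).symm
        refine (Homotopy.ofEq ?_).trans ((((h₂.some.compLeft (e.hom ≫ biprod.snd)).compRight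
          (biprod.inr ≫ e.inv)).add
            (Homotopy.refl ((e.hom ≫ biprod.fst) ≫ biprod.inl ≫ e.inv))).trans (Homotopy.ofEq ?_))
        · have := congrArg (fun φ => e.hom ≫ φ ≫ e.inv) (biprod.total (X := I₁) (Y := I₂))
          simp only [Preadditive.comp_add, Preadditive.add_comp, Category.assoc, Category.id_comp,
            Iso.hom_inv_id] at this
          simp only [Category.assoc, Category.comp_id]
          rw [← this, add_comm]
        · simp
      · rw [← Functor.map_comp, hip, CategoryTheory.Functor.map_id]
    exact hf.pureQuasiIso.comp_of_isIso _
  · refine (hf.pureInjective i).of_retract ((biprod.inl ≫ e.inv).f i).hom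
      ((e.hom ≫ biprod.fst).f i).hom ?_
    exact congrArg ModuleCat.Hom.hom (HomologicalComplex.congr_hom hip i)
  · refine (hf.hom_preserves X hX).of_retract (homComplexMap X (biprod.inl ≫ e.inv))
      (homComplexMap X (e.hom ≫ biprod.fst)) ?_
    ext n c
    change ((show Cochain X I₁ n from c).comp (Cochain.ofHom _) (add_zero n)).comp
      (Cochain.ofHom _) (add_zero n) = c
    rw [Cochain.comp_assoc_of_third_is_zero_cochain, ← Cochain.ofHom_comp, hip, Cochain.comp_id]

theorem SplitAbove.hasResolutionUpTo {Y I : CochainComplex (ModuleCat.{u} R) ℤ} {n : ℤ}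
    (hI : SplitAbove I n) {f : Y ⟶ I} (hf : IsPureInjectiveResolution f) :
    HasResolutionUpTo Y n := by
  obtain ⟨I₁, I₂, ⟨e⟩, h₁, h₂⟩ := hI.exists_iso_biprod
  exact ⟨I₁, _, hf.comp_fst e h₂, h₁⟩

theorem HasResolutionUpTo.splitAbove {Y I : CochainComplex (ModuleCat.{u} R) ℤ} {n : ℤ}
    (h : HasResolutionUpTo Y n) {f : Y ⟶ I} (hf : IsPureInjectiveResolution f) :
    SplitAbove I n := by
  obtain ⟨J, f', hf', hJ⟩ := h
  obtain ⟨g, g', ⟨H⟩⟩ := hf'.exists_homotopy hf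
  exact splitAbove_of_homotopy H hJ

/-- Since `d h d = d`, the map `1 - h d` is a retraction of `I^n` onto `Ker d^n`. -/
theorem SplitAbove.pureInjective_ker {I : CochainComplex (ModuleCat.{u} R) ℤ} {n : ℤ}
    (hI : SplitAbove I n) (hE : PureInjective R (I.X n)) :
    PureInjective R (LinearMap.ker (I.d n (n + 1)).hom) := by
  obtain ⟨h, hh⟩ := hI
  have key := SplitAbove.d_comp_comp_d hh rfl
  refine hE.of_retract (Submodule.subtype _) (LinearMap.codRestrict _
    (𝟙 _ - I.d n (n + 1) ≫ h.v (n + 1) n (by lia)).hom fun x => ?_)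
    (LinearMap.ext fun x => Subtype.ext ?_)
  · have : (𝟙 _ - I.d n (n + 1) ≫ h.v (n + 1) n (by lia)) ≫ I.d n (n + 1) = 0 := by
      rw [Preadditive.sub_comp, Category.assoc, key, Category.id_comp, sub_self]
    exact LinearMap.congr_fun (congrArg ModuleCat.Hom.hom this) x
  · change x.1 - h.v (n + 1) n _ (I.d n (n + 1) x.1) = x.1
    rw [show I.d n (n + 1) x.1 = 0 from x.2, map_zero, sub_zero]

theorem pid_le_iff (Y : CochainComplex (ModuleCat.{u} R) ℤ) (n : ℤ) :
    pid Y ≤ ext n ↔ HasResolutionUpTo Y n := by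
  constructor
  · intro h
    by_contra hn
    have hlt : ext n < pid Y := by
      -- The admissible bounds are integers greater than `n`, so their infimum is at least `n + 1`.
      have h1 : ext (n + 1) ≤ pid Y := by
        refine le_sInf ?_
        rintro _ ⟨m, ⟨I, f, hf, hI⟩, rfl⟩
        have : n + 1 ≤ m := by
          by_contra hm
          exact hn ⟨I, f, hf, fun i hi => hI i (by lia)⟩
        exact EReal.coe_le_coe_iff.2 (by exact_mod_cast this)
      refine lt_of_lt_of_le ?_ h1
      exact EReal.coe_lt_coe_iff.2 (by exact_mod_cast Int.lt_succ n)
    exact absurd h (not_le.2 hlt)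
  · intro h
    exact sInf_le ⟨n, h, rfl⟩

end SplitAbove

/-! ### Pure exactness in high degrees under pure quasi-isomorphisms -/

section Tail

variable {R : Type u} [Ring R]

/-- The complex is pure exact in degrees `> n`, in terms of cycles and boundaries. -/
structure PureTail (X : CochainComplex (ModuleCat.{u} R) ℤ) (n : ℤ) : Prop where
  isPure : ∀ m, n ≤ m → IsPure (LinearMap.ker (X.d m (m + 1)).hom)
  exact : ∀ m k, n ≤ m → m + 1 + 1 = k → ∀ x : X.X (m + 1), X.d (m + 1) k x = 0 →
    ∃ y, X.d m (m + 1) y = x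

theorem d_d_apply (X : CochainComplex (ModuleCat.{u} R) ℤ) (i j k : ℤ) (x : X.X i) :
    X.d j k (X.d i j x) = 0 :=
  LinearMap.congr_fun (congrArg ModuleCat.Hom.hom (X.d_comp_d i j k)) x

theorem f_d_apply {X Y : CochainComplex (ModuleCat.{u} R) ℤ} (f : X ⟶ Y) (i j : ℤ) (x : X.X i) :
    f.f j (X.d i j x) = Y.d i j (f.f i x) :=
  LinearMap.congr_fun (congrArg ModuleCat.Hom.hom (f.comm i j).symm) x

theorem PureTail.range_eq_ker {X : CochainComplex (ModuleCat.{u} R) ℤ} {n : ℤ} (h : PureTail X n)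
    (m k : ℤ) (hm : n ≤ m) (hk : m + 1 + 1 = k) :
    LinearMap.range (X.d m (m + 1)).hom = LinearMap.ker (X.d (m + 1) k).hom := by
  refine le_antisymm ?_ fun x hx => h.exact m k hm hk x hx
  rintro _ ⟨x, rfl⟩
  exact d_d_apply X _ _ _ x

/-- Pure exactness at `n + 1` already contains purity of `Ker d^n`, so purity starts at `n` while
exactness starts at `n + 1`. -/
theorem pureTail_iff (X : CochainComplex (ModuleCat.{u} R) ℤ) (n : ℤ) :
    PureTail X n ↔ ∀ m, n < m → PureExactAt X m := by
  constructor
  · intro h m hm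
    obtain ⟨l, rfl⟩ : ∃ l, m = l + 1 := ⟨m - 1, by lia⟩
    refine (pureExactAt_iff X rfl rfl).2 ⟨h.range_eq_ker l _ (by lia) rfl, h.isPure l (by lia),
      h.isPure (l + 1) (by lia), ?_⟩
    rw [h.range_eq_ker (l + 1) _ (by lia) rfl]
    exact h.isPure _ (by lia)
  · intro h
    refine ⟨fun m hm => ((pureExactAt_iff X rfl rfl).1 (h (m + 1) (by lia))).2.1,
      fun m k hm hk x hx => ?_⟩
    have := ((pureExactAt_iff X rfl hk).1 (h (m + 1) (by lia))).1
    have hx' : x ∈ LinearMap.ker (X.d (m + 1) k).hom := hx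
    rw [← this] at hx'
    exact hx'

theorem supp_le_iff (X : CochainComplex (ModuleCat.{u} R) ℤ) (n : ℤ) :
    supp X ≤ ext n ↔ PureTail X n := by
  rw [pureTail_iff]
  constructor
  · intro h m hm
    by_contra hn
    have h1 : ext m ≤ ext n := (le_sSup (Set.mem_image_of_mem ext hn)).trans h
    have h2 : m ≤ n := by exact_mod_cast EReal.coe_le_coe_iff.1 h1
    lia
  · intro h
    refine sSup_le ?_
    rintro _ ⟨m, hm, rfl⟩
    refine EReal.coe_le_coe_iff.2 ?_
    by_contra hn
    exact hm (h m (by exact_mod_cast not_le.1 hn))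

theorem le_infp_iff (X : CochainComplex (ModuleCat.{u} R) ℤ) (n : ℤ) :
    ext n ≤ infp X ↔ ∀ m, m < n → PureExactAt X m := by
  constructor
  · intro h m hm
    by_contra hn
    have h1 : ext n ≤ ext m := h.trans (sInf_le (Set.mem_image_of_mem ext hn))
    have h2 : n ≤ m := by exact_mod_cast EReal.coe_le_coe_iff.1 h1
    lia
  · intro h
    refine le_sInf ?_
    rintro _ ⟨m, hm, rfl⟩
    refine EReal.coe_le_coe_iff.2 ?_
    by_contra hn
    exact hm (h m (by exact_mod_cast not_le.1 hn))

/-- Pure exactness in high degrees passes along pure quasi-isomorphisms `Y ⟶ I`. -/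
theorem PureTail.of_pureQuasiIso {Y I : CochainComplex (ModuleCat.{u} R) ℤ} {f : Y ⟶ I} {n : ℤ}
    (hY : PureTail Y n) (hf : PureQuasiIso f) : PureTail I n where
  isPure m hm E _ _ hE φ := by
    have hmem (x : LinearMap.ker (Y.d m (m + 1)).hom) :
        f.f m x.1 ∈ LinearMap.ker (I.d m (m + 1)).hom := by
      change I.d m (m + 1) (f.f m x.1) = 0
      rw [← f_d_apply, show Y.d m (m + 1) x.1 = 0 from x.2, map_zero]
    have hmem' (x : I.X (m - 1)) : I.d (m - 1) m x ∈ LinearMap.ker (I.d m (m + 1)).hom :=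
      d_d_apply I _ _ _ x
    -- Extend `φ ∘ f` from the cycles of `Y` to `α` on `Y^m`. Then `(α, φ ∘ d)` kills the boundaries
    -- of the cone, and the resulting `γ` extends `φ` since every cycle of `I` has the form `f x + d
    -- y`.
    obtain ⟨α, hα⟩ := hY.isPure m hm E hE
      (φ ∘ₗ LinearMap.codRestrict _ ((f.f m).hom ∘ₗ Submodule.subtype _) hmem)
    obtain ⟨β, γ, h₁, h₂⟩ := hf.exists_factor (E := ModuleCat.of R E) hE (h := m - 1 - 1)
      (i := m - 1) (j := m) (k := m + 1) (by lia) (by lia) rfl (ModuleCat.ofHom α)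
      (ModuleCat.ofHom (φ ∘ₗ LinearMap.codRestrict _ (I.d (m - 1) m).hom hmem'))
      (by
        refine ModuleCat.hom_ext (LinearMap.ext fun x => ?_)
        exact (congrArg φ (Subtype.ext (d_d_apply I _ _ _ x))).trans (map_zero φ))
      (by
        refine ModuleCat.hom_ext (LinearMap.ext fun x => ?_)
        refine Eq.trans ?_ (LinearMap.congr_fun hα ⟨Y.d (m - 1) m x, d_d_apply Y _ _ _ x⟩).symm
        exact congrArg φ (Subtype.ext (f_d_apply f _ _ x).symm))
    refine ⟨γ.hom, LinearMap.ext ?_⟩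
    rintro ⟨z, hz⟩
    obtain ⟨x, y, hx, rfl⟩ := hf.exists_of_d_eq_zero (sub_add_cancel m 1) rfl z hz
    have h3 : α x = γ (f.f m x) - β (Y.d m (m + 1) x) :=
      LinearMap.congr_fun (congrArg ModuleCat.Hom.hom h₁) x
    rw [hx, map_zero, sub_zero] at h3
    have h4 : φ ⟨_, hmem' y⟩ = γ (I.d (m - 1) m y) :=
      LinearMap.congr_fun (congrArg ModuleCat.Hom.hom h₂) y
    have h5 : α x = φ ⟨_, hmem ⟨x, hx⟩⟩ := LinearMap.congr_fun hα ⟨x, hx⟩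
    change γ (f.f m x + I.d (m - 1) m y) = _
    rw [map_add, ← h3, ← h4, h5, ← map_add]
    rfl
  exact m k hm hk z hz := by
    obtain ⟨x, y, hx, rfl⟩ := hf.exists_of_d_eq_zero rfl hk z hz
    obtain ⟨x', rfl⟩ := hY.exact m k hm hk x hx
    exact ⟨f.f m x' + y, by rw [map_add, f_d_apply]⟩

/-- A complex with a pure quasi-isomorphism to a complex vanishing in degrees `> n` is pure exact
in these degrees. -/
theorem pureTail_of_isZero {Y I : CochainComplex (ModuleCat.{u} R) ℤ} {f : Y ⟶ I} {n : ℤ}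
    (hf : PureQuasiIso f) (hI : ∀ i, n < i → IsZero (I.X i)) : PureTail Y n where
  isPure m hm E _ _ hE φ := by
    have hzero (x : I.X (m + 1)) : x = 0 := by
      have := ModuleCat.subsingleton_of_isZero (hI (m + 1) (by lia))
      exact Subsingleton.elim _ _
    have hmem (x : Y.X (m - 1)) : Y.d (m - 1) m x ∈ LinearMap.ker (Y.d m (m + 1)).hom :=
      d_d_apply Y _ _ _ x
    -- Applied to the pair `(φ ∘ d, 0)`, this gives `φ d = γ f - β d` and `γ d = 0`.
    obtain ⟨β, γ, h₁, h₂⟩ := hf.exists_factor (E := ModuleCat.of R E) hE (h := m - 1 - 1 - 1)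
      (i := m - 1 - 1) (j := m - 1) (k := m) (by lia) (by lia) (by lia)
      (ModuleCat.ofHom (φ ∘ₗ LinearMap.codRestrict _ (Y.d (m - 1) m).hom hmem)) 0 comp_zero
      (by
        refine ModuleCat.hom_ext (LinearMap.ext fun x => ?_)
        exact ((congrArg φ (Subtype.ext (d_d_apply Y _ _ _ x))).trans (map_zero φ)).symm)
    have h₁' (x : Y.X (m - 1)) : φ ⟨_, hmem x⟩ = γ (f.f (m - 1) x) - β (Y.d (m - 1) m x) :=
      LinearMap.congr_fun (congrArg ModuleCat.Hom.hom h₁) x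
    have h₂' (x : I.X (m - 1 - 1)) : γ (I.d (m - 1 - 1) (m - 1) x) = 0 :=
      (LinearMap.congr_fun (congrArg ModuleCat.Hom.hom h₂) x).symm
    -- Onto because `I^{m+1} = 0` makes all of `I^m` cycles. The pair `(φ + β, γ)` vanishes on its
    -- kernel, so it descends to `k` on `I^m`, and `k f - β` extends `φ`.
    let g : LinearMap.ker (Y.d m (m + 1)).hom × I.X (m - 1) →ₗ[R] I.X m :=
      ((f.f m).hom ∘ₗ Submodule.subtype _).coprod (I.d (m - 1) m).hom
    have hg : Function.Surjective g := fun z => by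
      obtain ⟨x, y, hx, rfl⟩ := hf.exists_of_d_eq_zero (sub_add_cancel m 1) rfl z (hzero _)
      exact ⟨(⟨x, hx⟩, y), rfl⟩
    obtain ⟨k, hk⟩ := exists_factor_of_surjective hg
      ((φ + β.hom ∘ₗ Submodule.subtype _).coprod γ.hom) (by
        rintro ⟨⟨x, hx⟩, y⟩ hxy
        obtain ⟨x', y', rfl, rfl⟩ := hf.exists_of_map_eq (sub_add_cancel (m - 1) 1)
          (sub_add_cancel m 1) rfl x y hx hxy
        change (φ ⟨_, hx⟩ + β (-Y.d (m - 1) m x')) + γ (f.f (m - 1) x' + I.d _ (m - 1) y') = 0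
        have h3 : φ ⟨_, hx⟩ = - φ ⟨_, hmem x'⟩ := map_neg φ ⟨_, hmem x'⟩
        rw [h3, h₁', map_neg, map_add, h₂']
        abel)
    refine ⟨k ∘ₗ (f.f m).hom - β.hom, LinearMap.ext fun x => ?_⟩
    have h4 : k (f.f m x.1 + I.d (m - 1) m 0) = (φ x + β x.1) + γ 0 :=
      LinearMap.congr_fun hk (x, 0)
    rw [map_zero, map_zero, add_zero, add_zero] at h4
    change k (f.f m x.1) - β x.1 = φ x
    rw [h4, add_sub_cancel_right]
  exact m k hm hk z hz := by
    obtain ⟨x', y', hx, -⟩ := hf.exists_of_map_eq (sub_add_cancel m 1) rfl hk z 0 hz (by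
      have := ModuleCat.subsingleton_of_isZero (hI (m + 1) (by lia))
      exact Subsingleton.elim _ _)
    exact ⟨-x', by rw [map_neg, hx]⟩

end Tail

/-! ### Contracting a complex from sections onto its cycles -/

section Splitting

open CochainComplex CochainComplex.HomComplex

variable {R : Type u} [Ring R]

/-- Sections of the differentials onto the cycles in degrees `> n` yield a contraction of the
complex in these degrees. -/
theorem splitAbove_of_sections {I : CochainComplex (ModuleCat.{u} R) ℤ} {n : ℤ}
    (hs : ∀ l m k, n ≤ l → l + 1 = m → m + 1 = k →
      ∃ s : LinearMap.ker (I.d m k).hom →ₗ[R] I.X l, ∀ z, I.d l m (s z) = z.1) :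
    SplitAbove I n := by
  choose s hs using hs
  let r (m k j : ℤ) (hm : n ≤ m) (hmk : m + 1 = k) (hkj : k + 1 = j) :
      I.X m →ₗ[R] LinearMap.ker (I.d m k).hom :=
    LinearMap.codRestrict _ (LinearMap.id - s m k j hm hmk hkj ∘ₗ
      LinearMap.codRestrict _ (I.d m k).hom fun x => d_d_apply I m k j x) fun x => by
        change I.d m k (x - s m k j hm hmk hkj ⟨I.d m k x, _⟩) = 0
        rw [map_sub, hs, sub_self]
  -- The sections are defined only on cycles, so `1 - s d` first projects `I^p` onto them.
  let h : Cochain I I (-1) := Cochain.mk fun p q hpq =>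
    if hp : n < p then ModuleCat.ofHom (s q p (p + 1) (by lia) (by lia) rfl ∘ₗ
      r p (p + 1) (p + 1 + 1) hp.le rfl rfl) else 0
  refine ⟨h, fun m hm => ?_⟩
  rw [δ_neg_one_v h (sub_add_cancel m 1) rfl, Cochain.mk_v, Cochain.mk_v, dif_pos hm,
    dif_pos (by lia)]
  refine ModuleCat.hom_ext (LinearMap.ext fun x => ?_)
  change I.d (m - 1) m (s (m - 1) m (m + 1) _ _ _ (r m (m + 1) (m + 1 + 1) _ _ _ x)) +
    s m (m + 1) (m + 1 + 1) _ _ _ (r (m + 1) (m + 1 + 1) (m + 1 + 1 + 1) _ _ _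
      (I.d m (m + 1) x)) = x
  rw [hs]
  have h2 : r (m + 1) (m + 1 + 1) (m + 1 + 1 + 1) (by lia) rfl rfl (I.d m (m + 1) x) =
      ⟨I.d m (m + 1) x, d_d_apply I _ _ _ x⟩ := by
    refine Subtype.ext ?_
    change I.d m (m + 1) x - s _ _ _ _ _ _ ⟨I.d _ _ (I.d m (m + 1) x), _⟩ = _
    have : (⟨I.d (m + 1) (m + 1 + 1) (I.d m (m + 1) x), d_d_apply I _ _ _ _⟩ :
      LinearMap.ker (I.d (m + 1 + 1) (m + 1 + 1 + 1)).hom) = 0 := Subtype.ext (d_d_apply I _ _ _ x)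
    rw [this, map_zero, sub_zero]
  rw [h2]
  exact sub_add_cancel _ _

/-- A pure injective pure submodule is a direct summand, so `I^l` retracts onto `Ker d^l` and the
surjection of `I^l` onto `Ker d^{l+1}` has a section. This makes `Ker d^{l+1}` a retract of `I^l`,
hence pure injective, and the argument repeats. -/
theorem PureTail.splitAbove {I : CochainComplex (ModuleCat.{u} R) ℤ} {n : ℤ} (hI : PureTail I n)
    (hker : PureInjective R (LinearMap.ker (I.d n (n + 1)).hom))
    (hE : ∀ i, PureInjective R (I.X i)) : SplitAbove I n := by
  have step (l m k : ℤ) (hl : n ≤ l) (hlm : l + 1 = m) (hmk : m + 1 = k)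
      (hinj : PureInjective R (LinearMap.ker (I.d l m).hom)) :
      ∃ s : LinearMap.ker (I.d m k).hom →ₗ[R] I.X l, ∀ z, I.d l m (s z) = z.1 := by
    subst hlm
    obtain ⟨r, hr⟩ := hI.isPure l hl _ hinj LinearMap.id
    let d : I.X l →ₗ[R] LinearMap.ker (I.d (l + 1) k).hom :=
      LinearMap.codRestrict _ (I.d l (l + 1)).hom fun x => d_d_apply I _ _ _ x
    have hd : Function.Surjective d := fun z => by
      obtain ⟨y, hy⟩ := hI.exact l k hl hmk z.1 z.2
      exact ⟨y, Subtype.ext hy⟩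
    obtain ⟨s, hs⟩ := exists_factor_of_surjective hd
      (LinearMap.id - Submodule.subtype _ ∘ₗ r) fun x hx => by
        have hx' : I.d l (l + 1) x = 0 := congrArg Subtype.val (show d x = 0 from hx)
        change x - (r x).1 = 0
        rw [sub_eq_zero]
        exact (congrArg Subtype.val (LinearMap.congr_fun hr ⟨x, hx'⟩)).symm
    refine ⟨s, fun z => ?_⟩
    obtain ⟨y, rfl⟩ := hd z
    have : s (d y) = y - (r y).1 := LinearMap.congr_fun hs y
    rw [this, map_sub, show I.d l (l + 1) (r y).1 = 0 from (r y).2, sub_zero]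
    rfl
  have hinj (m : ℤ) (hm : n ≤ m) : PureInjective R (LinearMap.ker (I.d m (m + 1)).hom) := by
    induction m, hm using Int.leInduction with
    | base => exact hker
    | succ m hm ih =>
      obtain ⟨s, hs⟩ := step m (m + 1) (m + 1 + 1) hm rfl rfl ih
      exact (hE m).of_retract s (LinearMap.codRestrict _ (I.d m (m + 1)).hom
        fun x => d_d_apply I _ _ _ x) (LinearMap.ext fun z => Subtype.ext (hs z))
  refine splitAbove_of_sections fun l m k hl hlm hmk => step l m k hl hlm hmk ?_
  subst hlm
  exact hinj l hl

end Splitting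

/-! ### Low-degree truncations -/

section Subcomplex

variable {R : Type u} [Ring R]

/-- The subcomplex given by submodules that are stable under the differential. -/
def subcomplex (X : CochainComplex (ModuleCat.{u} R) ℤ) (S : ∀ i, Submodule R (X.X i))
    (hS : ∀ i j, ∀ x ∈ S i, X.d i j x ∈ S j) : CochainComplex (ModuleCat.{u} R) ℤ where
  X i := ModuleCat.of R (S i)
  d i j := ModuleCat.ofHom ((X.d i j).hom.restrict (hS i j))
  shape i j hij := ModuleCat.hom_ext (LinearMap.ext fun x => Subtype.ext
    (LinearMap.congr_fun (congrArg ModuleCat.Hom.hom (X.shape i j hij)) x.1))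
  d_comp_d' i j k _ _ := ModuleCat.hom_ext (LinearMap.ext fun x => Subtype.ext
    (d_d_apply X i j k x.1))

/-- The inclusion of a subcomplex. -/
def subcomplexι (X : CochainComplex (ModuleCat.{u} R) ℤ) (S : ∀ i, Submodule R (X.X i))
    (hS : ∀ i j, ∀ x ∈ S i, X.d i j x ∈ S j) : subcomplex X S hS ⟶ X where
  f i := ModuleCat.ofHom (S i).subtype
  comm' _ _ _ := rfl

/-- The submodules of the truncation `⋯ → X^{a-1} → X^a → Im d^a → 0`. -/
def truncation (X : CochainComplex (ModuleCat.{u} R) ℤ) (a i : ℤ) : Submodule R (X.X i) :=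
  if i ≤ a then ⊤ else if i = a + 1 then LinearMap.range (X.d (i - 1) i).hom else ⊥

theorem mem_truncation_of_le {X : CochainComplex (ModuleCat.{u} R) ℤ} {a i : ℤ} (hi : i ≤ a)
    (x : X.X i) : x ∈ truncation X a i := by
  rw [truncation, if_pos hi]
  trivial

theorem exists_of_mem_truncation {X : CochainComplex (ModuleCat.{u} R) ℤ} {a i j : ℤ}
    (hi : i + 1 = j) (hj : a < j) {x : X.X j} (hx : x ∈ truncation X a j) :
    ∃ y ∈ truncation X a i, X.d i j y = x := by
  obtain rfl : i = j - 1 := by lia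
  rw [truncation, if_neg (not_le.2 hj)] at hx
  split_ifs at hx with h
  · obtain ⟨y, rfl⟩ := hx
    exact ⟨y, mem_truncation_of_le (by lia) y, rfl⟩
  · obtain rfl : x = 0 := hx
    exact ⟨0, Submodule.zero_mem _, map_zero _⟩

theorem d_mem_truncation (X : CochainComplex (ModuleCat.{u} R) ℤ) (a i j : ℤ) (x : X.X i)
    (hx : x ∈ truncation X a i) : X.d i j x ∈ truncation X a j := by
  by_cases hij : i + 1 = j
  · subst hij
    by_cases hi : i ≤ a
    · by_cases hi' : i + 1 ≤ a
      · exact mem_truncation_of_le hi' _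
      · obtain rfl : i = a := by lia
        rw [truncation, if_neg (by lia), if_pos rfl, add_sub_cancel_right]
        exact ⟨x, rfl⟩
    · obtain ⟨y, -, rfl⟩ := exists_of_mem_truncation (sub_add_cancel i 1) (not_le.1 hi) hx
      rw [d_d_apply]
      exact Submodule.zero_mem _
  · have : X.d i j x = 0 :=
      LinearMap.congr_fun (congrArg ModuleCat.Hom.hom (X.shape i j hij)) x
    rw [this]
    exact Submodule.zero_mem _

/-- Only degree `a + 1` matters: `Im d^a` is pure by pure exactness at `a`. -/
theorem isPure_truncation {X : CochainComplex (ModuleCat.{u} R) ℤ} {a : ℤ}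
    (hX : PureExactAt X a) (i : ℤ) : IsPure (truncation X a i) := by
  rw [truncation]
  split_ifs with h h'
  · exact isPure_top
  · subst h'
    rw [add_sub_cancel_right]
    exact ((pureExactAt_iff X (sub_add_cancel a 1) rfl).1 hX).2.2.2
  · exact isPure_bot

/-- Up to degree `a` a map factors as it does on `X`. Above `a` every element is a boundary, so a
map killing boundaries is zero. -/
theorem pureExact_truncation {X : CochainComplex (ModuleCat.{u} R) ℤ} {a : ℤ}
    (hX : ∀ k ≤ a, PureExactAt X k) :
    PureExact (subcomplex X (truncation X a) (d_mem_truncation X a)) := by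
  refine pureExact_of_exists_factor fun E hE i j k hij hjk φ hφ => ?_
  have hφ' (y : X.X i) (hy : y ∈ truncation X a i) :
      φ.hom ⟨X.d i j y, d_mem_truncation X a i j y hy⟩ = 0 :=
    LinearMap.congr_fun (congrArg ModuleCat.Hom.hom hφ) ⟨y, hy⟩
  by_cases hj : j ≤ a
  · obtain ⟨h₁, -, -, h₂⟩ := (pureExactAt_iff X hij hjk).1 (hX j hj)
    obtain ⟨ψ, hψ⟩ := ModuleCat.exists_factor_of_isPure_range (X.d j k) h₂ hE
      (ModuleCat.ofHom (φ.hom ∘ₗ LinearMap.codRestrict (truncation X a j) LinearMap.id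
        (mem_truncation_of_le hj))) fun x hx => by
          have hx' : x ∈ LinearMap.ker (X.d j k).hom := hx
          rw [← h₁] at hx'
          obtain ⟨y, rfl⟩ := hx'
          exact hφ' y (mem_truncation_of_le (by lia) y)
    refine ⟨ModuleCat.ofHom (ψ.hom ∘ₗ Submodule.subtype _), ?_⟩
    exact ModuleCat.hom_ext (LinearMap.ext fun x =>
      LinearMap.congr_fun (congrArg ModuleCat.Hom.hom hψ) x.1)
  · refine ⟨0, ?_⟩
    rw [comp_zero]
    refine ModuleCat.hom_ext (LinearMap.ext fun x => ?_)
    obtain ⟨x, hx⟩ := x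
    obtain ⟨y, hy, rfl⟩ := exists_of_mem_truncation hij (not_le.1 hj) hx
    exact (hφ' y hy).symm

end Subcomplex

/-! ### Vanishing of Pext and splitting of the resolution -/

section Pext

open CochainComplex CochainComplex.HomComplex

variable {R : Type u} [Ring R]

theorem isZero_homology_homComplex_iff (X I : CochainComplex (ModuleCat.{u} R) ℤ) (i : ℤ) :
    IsZero ((homComplex X I).homology i) ↔ ∀ z : Cochain X I i, δ i (i + 1) z = 0 →
      ∃ y : Cochain X I (i - 1), δ (i - 1) i y = z := by
  rw [← HomologicalComplex.exactAt_iff_isZero_homology,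
    HomologicalComplex.exactAt_iff' _ (i - 1) i (i + 1) (by simp) (by simp),
    ShortComplex.moduleCat_exact_iff]
  rfl

/-- On the pure exact truncation `T` of `X` at `n - i`, the restriction of `z` is a coboundary. Its
primitive extends to a cochain `y'` on `X`, because `T` is degreewise pure and the terms of `I` are
pure injective. The cocycle `c = z - δ y'` vanishes on `T`, and composing it with the contraction
`h` of `I` gives a primitive. -/
theorem SplitAbove.exists_primitive {I X : CochainComplex (ModuleCat.{u} R) ℤ} {n i : ℤ}
    (hI : SplitAbove I n) (hE : ∀ i, PureInjective R (I.X i))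
    (hpres : ∀ X : CochainComplex (ModuleCat.{u} R) ℤ, PureExact X → PureExact (homComplex X I))
    (hX : ∀ k ≤ n - i, PureExactAt X k) (z : Cochain X I i) (hz : δ i (i + 1) z = 0) :
    ∃ y : Cochain X I (i - 1), δ (i - 1) i y = z := by
  let T := subcomplex X (truncation X (n - i)) (d_mem_truncation X (n - i))
  let ι : T ⟶ X := subcomplexι X _ _
  obtain ⟨y, hy⟩ := (hpres T (pureExact_truncation hX)).exists_of_d_eq_zero
    (sub_add_cancel i 1) rfl ((Cochain.ofHom ι).comp z (zero_add i))
    ((δ_ofHom_comp ι z (i + 1)).trans (by rw [hz, Cochain.comp_zero]; rfl))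
  have hext (p q : ℤ) (hpq : p + (i - 1) = q) : ∃ y' : X.X p ⟶ I.X q,
      ι.f p ≫ y' = Cochain.v (show Cochain T I (i - 1) from y) p q hpq := by
    obtain ⟨ψ, hψ⟩ := isPure_truncation (hX _ le_rfl) p _ (hE q)
      (Cochain.v (show Cochain T I (i - 1) from y) p q hpq).hom
    exact ⟨ModuleCat.ofHom ψ, ModuleCat.hom_ext hψ⟩
  choose y' hy' using hext
  have hy'' : (Cochain.ofHom ι).comp (Cochain.mk y') (zero_add (i - 1)) = y := by
    refine Cochain.ext _ _ fun p q hpq => ?_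
    rw [Cochain.zero_cochain_comp_v, Cochain.ofHom_v, Cochain.mk_v]
    exact hy' p q hpq
  have h0 : (Cochain.ofHom ι).comp (z - δ (i - 1) i (Cochain.mk y')) (zero_add i) = 0 := by
    rw [Cochain.comp_sub, sub_eq_zero, ← δ_ofHom_comp, hy'']
    exact hy.symm
  obtain ⟨h, hh⟩ := hI
  refine ⟨Cochain.mk y' + (z - δ (i - 1) i (Cochain.mk y')).comp h (by omega), ?_⟩
  have hcl : δ i (i + 1) (z - δ (i - 1) i (Cochain.mk y')) = 0 := by
    rw [δ_sub, hz, δ_δ, sub_zero]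
  rw [δ_add, δ_comp _ h (show i + -1 = i - 1 by omega) (i + 1) 0 i (by omega) rfl (by omega), hcl,
    Cochain.zero_comp, smul_zero, add_zero]
  suffices hs : (z - δ (i - 1) i (Cochain.mk y')).comp (δ (-1) 0 h) (add_zero i) =
      z - δ (i - 1) i (Cochain.mk y') by
    rw [hs, add_sub_cancel]
  refine Cochain.ext _ _ fun p q hpq => ?_
  rw [Cochain.comp_zero_cochain_v]
  -- For `p ≤ n - i` the cocycle vanishes on `X^p = T^p`; for `p > n - i` it lands in degree `p + i
  -- > n`, where `δ h = 1`.
  by_cases hp : p ≤ n - i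
  · have h1 := Cochain.congr_v h0 p q hpq
    rw [Cochain.zero_cochain_comp_v, Cochain.ofHom_v, Cochain.zero_v] at h1
    have h2 : (z - δ (i - 1) i (Cochain.mk y')).v p q hpq = 0 :=
      ModuleCat.hom_ext (LinearMap.ext fun x => LinearMap.congr_fun
        (congrArg ModuleCat.Hom.hom h1) ⟨x, mem_truncation_of_le hp x⟩)
    rw [h2, zero_comp]
  · rw [hh q (by omega), Category.comp_id]

/-- Vanishing of `Pext` from a module gives lifts of cocycles. -/
theorem exists_lift_of_isZero {I : CochainComplex (ModuleCat.{u} R) ℤ} {M : ModuleCat.{u} R}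
    {l m k : ℤ} (hlm : l + 1 = m) (hmk : m + 1 = k)
    (h : IsZero ((homComplex (stalk M) I).homology m)) (φ : M ⟶ I.X m) (hφ : φ ≫ I.d m k = 0) :
    ∃ ψ : M ⟶ I.X l, ψ ≫ I.d l m = φ := by
  rw [isZero_homology_homComplex_iff] at h
  let z : Cocycle ((singleFunctor (ModuleCat.{u} R) 0).obj M) I m :=
    Cocycle.fromSingleMk φ (zero_add m) k hmk hφ
  obtain ⟨y, hy⟩ := h z.1 (z.δ_eq_zero _)
  exact (Cocycle.fromSingleMk_mem_coboundaries_iff φ (zero_add m) k hmk hφ l hlm).1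
    ((mem_coboundaries_iff _ (m - 1) (by lia)).2 ⟨y, hy⟩)

/-- The test module is `Ker d^m` itself: a lift of its inclusion into `I^m` is a section. -/
theorem exists_section_of_isZero {I : CochainComplex (ModuleCat.{u} R) ℤ}
    {l m k : ℤ} (hlm : l + 1 = m) (hmk : m + 1 = k)
    (h : ∀ M : ModuleCat.{u} R, IsZero ((homComplex (stalk M) I).homology m)) :
    ∃ s : LinearMap.ker (I.d m k).hom →ₗ[R] I.X l, ∀ z, I.d l m (s z) = z.1 := by
  obtain ⟨s, hs⟩ := exists_lift_of_isZero (M := ModuleCat.of R (LinearMap.ker (I.d m k).hom))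
    hlm hmk (h _) (ModuleCat.ofHom (Submodule.subtype _))
    (ModuleCat.hom_ext (LinearMap.ext fun z => z.2))
  exact ⟨s.hom, fun z => LinearMap.congr_fun (congrArg ModuleCat.Hom.hom hs) z⟩

theorem zero_le_infp_stalk (M : ModuleCat.{u} R) : ext 0 ≤ infp (stalk M) := by
  rw [le_infp_iff]
  intro m hm
  have hz (j : ℤ) (hj : j ≠ 0) : Subsingleton ((stalk M).X j) :=
    ModuleCat.subsingleton_of_isZero (HomologicalComplex.isZero_single_obj_X _ _ _ _ hj)
  have hd (i j : ℤ) : ((stalk M).d i j).hom = 0 := by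
    rw [HomologicalComplex.single_obj_d]
    rfl
  refine (pureExactAt_iff (stalk M) (sub_add_cancel m 1) rfl).2 ⟨?_, ?_, ?_, ?_⟩
  · have := hz m (by lia)
    exact Subsingleton.elim _ _
  · rw [hd, LinearMap.ker_zero]
    exact isPure_top
  · rw [hd, LinearMap.ker_zero]
    exact isPure_top
  · rw [hd, LinearMap.range_zero]
    exact isPure_bot

theorem exists_chosenResolution {Y : CochainComplex (ModuleCat.{u} R) ℤ} (hY : InDbpur Y) :
    ∃ f : Y ⟶ chosenResolution Y, IsPureInjectiveResolution f := by
  rw [chosenResolution, dif_pos (exists_resolution hY)]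
  exact (exists_resolution hY).choose_spec

/-- Comparing `infp X` with a degree `k` where pure exactness fails replaces it by an integer, so
infinite values need no separate treatment. -/
theorem pureExactAt_of_ext_sub_infp_lt {X : CochainComplex (ModuleCat.{u} R) ℤ} {n i : ℤ}
    (h : ext n - infp X < ext i) : ∀ k ≤ n - i, PureExactAt X k := by
  intro k hk
  by_contra hn
  have h1 : infp X ≤ ext k := sInf_le (Set.mem_image_of_mem ext hn)
  have h2 : ext n - ext k ≤ ext n - infp X := EReal.sub_le_sub le_rfl h1
  have h3 := h2.trans_lt h
  rw [ext, ext, ext, ← EReal.coe_sub, EReal.coe_lt_coe_iff] at h3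
  have h4 : n - k < i := by exact_mod_cast h3
  lia

theorem ext_sub_infp_stalk_lt (M : ModuleCat.{u} R) {n i : ℤ} (h : n < i) :
    ext n - infp (stalk M) < ext i := by
  have h2 : ext n - infp (stalk M) ≤ ext n - ext 0 :=
    EReal.sub_le_sub le_rfl (zero_le_infp_stalk M)
  refine h2.trans_lt ?_
  rw [ext, ext, ext, ← EReal.coe_sub, EReal.coe_lt_coe_iff]
  have : ((n - 0 : ℤ) : ℝ) < (i : ℝ) := by exact_mod_cast (by lia : n - 0 < i)
  exact_mod_cast this

/-- With a section `s` onto the next cycles, `1 - s d` retracts `I^n` onto `Ker d^n`. -/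
theorem pureInjective_ker_of_section {I : CochainComplex (ModuleCat.{u} R) ℤ} {n : ℤ}
    (hE : PureInjective R (I.X n))
    (s : LinearMap.ker (I.d (n + 1) (n + 1 + 1)).hom →ₗ[R] I.X n)
    (hs : ∀ z, I.d n (n + 1) (s z) = z.1) :
    PureInjective R (LinearMap.ker (I.d n (n + 1)).hom) := by
  let D : I.X n →ₗ[R] LinearMap.ker (I.d (n + 1) (n + 1 + 1)).hom :=
    LinearMap.codRestrict _ (I.d n (n + 1)).hom fun x =>
      LinearMap.congr_fun (congrArg ModuleCat.Hom.hom (I.d_comp_d n (n + 1) (n + 1 + 1))) x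
  refine hE.of_retract (Submodule.subtype _)
    (LinearMap.codRestrict _ (LinearMap.id - s ∘ₗ D) fun x => ?_) ?_
  · rw [LinearMap.mem_ker, LinearMap.sub_apply, map_sub, sub_eq_zero]
    exact (hs (D x)).symm
  · ext x
    have hx : D x.1 = 0 := Subtype.ext x.2
    simp [hx]

end Pext

end PureDerived

end

/-! ### The equivalences -/

theorem theorem4p6 {R : Type u} [Ring R] (Y : CochainComplex (ModuleCat.{u} R) ℤ)
    (hY : PureDerived.InDbpur Y) (n : ℤ) :
    List.TFAE [
      PureDerived.pid Y ≤ PureDerived.ext n,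
      PureDerived.supp Y ≤ PureDerived.ext n ∧
        ∀ (I' : CochainComplex (ModuleCat.{u} R) ℤ) (f' : Y ⟶ I'),
          PureDerived.IsPureInjectiveResolution f' →
            PureDerived.PureInjective R (LinearMap.ker (I'.d n (n + 1)).hom),
      ∀ (I' : CochainComplex (ModuleCat.{u} R) ℤ) (f' : Y ⟶ I'),
        PureDerived.IsPureInjectiveResolution f' →
          ∃ I₁ I₂ : CochainComplex (ModuleCat.{u} R) ℤ, Nonempty (I' ≅ I₁ ⊞ I₂) ∧
            (∀ i : ℤ, n < i → IsZero (I₁.X i)) ∧ PureDerived.Contractible I₂,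
      ∀ (X : CochainComplex (ModuleCat.{u} R) ℤ) (i : ℤ),
        PureDerived.ext n - PureDerived.infp X < PureDerived.ext i →
          IsZero (PureDerived.Pext i X Y),
      PureDerived.supp Y ≤ PureDerived.ext n ∧
        ∀ M : ModuleCat.{u} R, IsZero (PureDerived.Pext (n + 1) (PureDerived.stalk M) Y)] := by
  open PureDerived in
  -- Working with the resolution that defines `Pext` makes statements about `Pext` literally
  -- statements about its Hom complexes.
  obtain ⟨f, hf⟩ := exists_chosenResolution hY
  rw [pid_le_iff, supp_le_iff]
  have tail (h : HasResolutionUpTo Y n) : PureTail Y n := by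
    obtain ⟨I, g, hg, hI⟩ := h
    exact pureTail_of_isZero hg.pureQuasiIso hI
  tfae_have 1 → 2 := fun h =>
    ⟨tail h, fun I' f' hf' => (h.splitAbove hf').pureInjective_ker (hf'.pureInjective n)⟩
  tfae_have 2 → 1 := fun h =>
    ((h.1.of_pureQuasiIso hf.pureQuasiIso).splitAbove (h.2 _ f hf)
      hf.pureInjective).hasResolutionUpTo hf
  tfae_have 1 → 3 := fun h I' f' hf' => (h.splitAbove hf').exists_iso_biprod
  tfae_have 3 → 1 := fun h => by
    obtain ⟨I₁, I₂, ⟨e⟩, h₁, h₂⟩ := h _ f hf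
    exact ⟨I₁, _, hf.comp_fst e h₂, h₁⟩
  tfae_have 1 → 4 := fun h X i hi =>
    (isZero_homology_homComplex_iff _ _ _).2 ((h.splitAbove hf).exists_primitive
      hf.pureInjective hf.hom_preserves (pureExactAt_of_ext_sub_infp_lt hi))
  tfae_have 4 → 1 := fun h =>
    (splitAbove_of_sections fun l m k hl hlm hmk => exists_section_of_isZero hlm hmk fun M =>
      h (stalk M) m (ext_sub_infp_stalk_lt M (by lia))).hasResolutionUpTo hf
  tfae_have 1 → 5 := fun h => ⟨tail h, fun M =>
    tfae_1_to_4 h (stalk M) (n + 1) (ext_sub_infp_stalk_lt M (by lia))⟩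
  tfae_have 5 → 1 := fun h => by
    obtain ⟨h₁, h₂⟩ := h
    have ht := h₁.of_pureQuasiIso hf.pureQuasiIso
    -- One degree of vanishing is enough: it makes `Ker d^n` pure injective, and the higher sections
    -- then follow from pure exactness above `n`.
    obtain ⟨s, hs⟩ := exists_section_of_isZero rfl rfl h₂
    exact (ht.splitAbove (pureInjective_ker_of_section (hf.pureInjective n) s hs)
      hf.pureInjective).hasResolutionUpTo hf
  tfae_finish
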